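/- **Corollary 4 (observability under relaxation).** Let $\mathfrak{her}_0(N)$ be the real space of traceless Hermitian $N\times N$ matrices, with the Hilbert–Schmidt scalar product. Let $\Sigma_M$ be the controlled open Markovian system $$\dot\rho=-(i\,\mathrm{ad}_{H_u}+\Gamma_L)(\rho),\quad H_u=H_d+\sum_{j=1}^m u_jH_j,\quad \Gamma_L(\rho)=\tfrac12\sum_{k=1}^r\bigl(V_k^\dagger V_k\rho+\rho V_k^\dagger V_k-2V_k\rho V_k^\dagger\bigr),$$ with $H_d,H_j$ Hermitian and traceless, $V_k$ arbitrary, real piecewise continuous controls $u(t)$ without bounds on the amplitudes, and output $y(t)=\mathrm{tr}(C^\dagger\rho(t))$, where $C$ is Hermitian and not scalar; put $\tilde C=C-\frac{\mathrm{tr}\,C}{N}\mathbf 1\ne0$. Let $\mathfrak k_c=\langle iH_j\rangle_{\rm Lie}$, $\mathfrak k_d=\langle iH_d,iH_j\rangle_{\rm Lie}$, $\mathfrak s_{\rm open}=\langle i\,\mathrm{ad}_{H_d}+\Gamma_L,\ i\,\mathrm{ad}_{H_j}\rangle_{\rm Lie}\subseteq\mathfrak{gl}(\mathfrak{her}_0(N))$.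 *Observability spaces.* For the closed system $\Sigma$ (without $\Gamma_L$), $\mathcal V(\Sigma,C)=\sum_{j\ge0}\mathrm{ad}_{\mathfrak k_d}^j\,\mathrm{span}\{i\tilde C\}$. For the open system, let $\mathcal H_T\subset\mathfrak{gl}(\mathfrak{her}_0(N))$ be the set of adjoints $F(T)^*$ of the solutions on $[0,T]$ of $\dot F=-(i\,\mathrm{ad}_{H_u}+\Gamma_L)\circ F$, $F(0)=\mathbf 1$, on $\mathfrak{her}_0(N)$ (over all controls), and $\mathcal H_{\le T}=\bigcup_{0\le t\le T}\mathcal H_t$. Let $\mathcal V_T$ and $\mathcal V_{\le T}$ be the real spans of $\{i\Phi(\tilde C):\Phi\in\mathcal H_T\}$ and $\{i\Phi(\tilde C):\Phi\in\mathcal H_{\le T}\}$ (measurement at time $T$, respectively at times up to $T$), and $\mathcal V(\Sigma_M,C)=\sum_{T\ge0}\mathcal V_T$. Assume that the system is fully controllable without relaxation, i.e. $\mathfrak k_d=\mathfrak{su}(N)$. Then $\mathcal V(\Sigma,C)=\mathfrak{su}(N)$; for every $T\ge0$ two density operators $\rho_A,\rho_B$ give the same output under all controls at all times in $[0,T]$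 if and only if $\mathrm{tr}((\rho_A-\rho_B)X)=0$ for all $X\in\mathcal V_{\le T}$; and: 1. If the system is H-controllable ($\mathfrak k_c=\mathfrak{su}(N)$), then $\mathcal V(\Sigma_M,C)=\mathcal V(\Sigma,C)$, and indeed $\mathcal V_T=\mathcal V(\Sigma,C)$ for every $T>0$. 2. If the system is weakly H-controllable ($\mathfrak k_d=\mathfrak{su}(N)$ and $\Gamma_L|_{\mathfrak{her}_0(N)}=\gamma\mathbf 1$ with $\gamma\ge0$), then for every $T\ge0$ $$\mathcal H_T=\{X\mapsto A^\dagger XA\;:\;A=e^{-\gamma T/2}U,\ U\in\mathcal R_T\},$$ where $\mathcal R_T\subseteq SU(N)$ is the set of operators $U(T)$ reached by the closed system $\dot U=-iH_uU$, $U(0)=\mathbf 1$; and for $T>0$ the space $\mathcal V_T$ is the image of $\mathfrak{su}(N)$ under the contraction $X\mapsto e^{-\gamma T}X$. 3. In general $\mathcal H_{\le T}$ is a set of invertible elements of $\mathfrak{gl}(\mathfrak{her}_0(N))$; $\mathcal H_{\le T}$ and $\mathcal V_{\le T}$ are nondecreasing in $T$, and so is $\dim\mathcal V_T$ for $T\ge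 0$. If $\Gamma_L|_{\mathfrak{her}_0(N)}\neq0$, which for $r\ge1$ holds for an open and dense set of Lindblad operators $(V_1,\dots,V_r)$, then the growth is strict: $\mathcal H_{\le T_1}\subsetneq\mathcal H_{\le T_2}$ for $0\le T_1<T_2$. If $\mathfrak s_{\rm open}=\mathfrak{gl}(\mathfrak{her}_0(N))$, then $\Gamma_L|_{\mathfrak{her}_0(N)}\ne0$, and for every $T>0$ the set $\mathcal H_{\le T}$ spans $\mathfrak{gl}(\mathfrak{her}_0(N))$ and $\mathcal V_{\le T}=\mathfrak{su}(N)$. -/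

import Mathlib

attribute [local instance 100] LieRing.ofAssociativeRing

noncomputable section

open Matrix Complex

open scoped ComplexOrder

namespace OpenQ

/-- Complex `N × N` matrices. -/
abbrev Mat (N : ℕ) : Type := Matrix (Fin N) (Fin N) ℂ

/-- `her₀(N)`: the real vector space of traceless Hermitian matrices. -/
def her0 (N : ℕ) : Submodule ℝ (Mat N) where
  carrier := {A | A.IsHermitian ∧ A.trace = 0}
  add_mem' := by
    rintro A B ⟨hA, hA'⟩ ⟨hB, hB'⟩
    exact ⟨hA.add hB, by rw [trace_add, hA', hB', add_zero]⟩
  zero_mem' := ⟨isHermitian_zero, trace_zero _ _⟩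
  smul_mem' := by
    rintro c A ⟨hA, hA'⟩
    refine ⟨?_, by rw [trace_smul, hA', smul_zero]⟩
    change (c • A)ᴴ = c • A
    rw [conjTranspose_smul, star_trivial, hA.eq]

/-- `su(N)`: the real Lie algebra of traceless skew-Hermitian matrices. -/
def su (N : ℕ) : LieSubalgebra ℝ (Mat N) where
  carrier := {A | Aᴴ = -A ∧ A.trace = 0}
  add_mem' := by
    rintro A B ⟨hA, hA'⟩ ⟨hB, hB'⟩
    exact ⟨by rw [conjTranspose_add, hA, hB, neg_add], by rw [trace_add, hA', hB', add_zero]⟩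
  zero_mem' := ⟨by simp, trace_zero _ _⟩
  smul_mem' := by
    rintro c A ⟨hA, hA'⟩
    exact ⟨by rw [conjTranspose_smul, star_trivial, hA, smul_neg],
      by rw [trace_smul, hA', smul_zero]⟩
  lie_mem' := by
    rintro A B ⟨hA, -⟩ ⟨hB, -⟩
    refine ⟨?_, ?_⟩
    · rw [Ring.lie_def, conjTranspose_sub, conjTranspose_mul, conjTranspose_mul, hA, hB]
      noncomm_ring
    · rw [Ring.lie_def, trace_sub, trace_mul_comm A B, sub_self]

/-- The superoperator `i ad_H : X ↦ i [H, X]`. -/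
def iad {N : ℕ} (H : Mat N) : Mat N →ₗ[ℝ] Mat N where
  toFun X := I • (H * X - X * H)
  map_add' X Y := by rw [← smul_add]; congr 1; noncomm_ring
  map_smul' c X := by
    rw [RingHom.id_apply, smul_comm c I, mul_smul_comm, smul_mul_assoc, smul_sub c]

/-- The relaxation term in GKS-Lindblad form with Lindblad operators `V₁, …, V_r`:
`Γ_L(X) = ½ ∑ₖ (Vₖ† Vₖ X + X Vₖ† Vₖ - 2 Vₖ X Vₖ†)`. -/
def relax {N r : ℕ} (V : Fin r → Mat N) : Mat N →ₗ[ℝ] Mat N where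
  toFun X := (1 / 2 : ℝ) •
    ∑ k, ((V k)ᴴ * V k * X + X * ((V k)ᴴ * V k) - (2 : ℝ) • (V k * X * (V k)ᴴ))
  map_add' X Y := by
    rw [← smul_add, ← Finset.sum_add_distrib]
    congr 1
    refine Finset.sum_congr rfl fun k _ => ?_
    rw [mul_add, add_mul X Y, mul_add (V k), add_mul (V k * X), smul_add]
    abel
  map_smul' c X := by
    rw [RingHom.id_apply, smul_comm c (1 / 2 : ℝ), Finset.smul_sum (r := c)]
    congr 1
    refine Finset.sum_congr rfl fun k _ => ?_
    rw [mul_smul_comm, smul_mul_assoc, mul_smul_comm, smul_mul_assoc, smul_comm (2 : ℝ) c,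
      smul_sub c, smul_add c]

theorem iad_mem_her0 {N : ℕ} {H : Mat N} (hH : H.IsHermitian) :
    ∀ X ∈ her0 N, iad H X ∈ her0 N := by
  rintro X ⟨hX, -⟩
  refine ⟨?_, ?_⟩
  · change (I • (H * X - X * H))ᴴ = I • (H * X - X * H)
    rw [conjTranspose_smul, conjTranspose_sub, conjTranspose_mul, conjTranspose_mul, hH.eq, hX.eq]
    simp only [RCLike.star_def, conj_I, neg_smul, ← smul_neg, neg_sub]
  · change (I • (H * X - X * H)).trace = 0
    rw [trace_smul, trace_sub, trace_mul_comm H X, sub_self, smul_zero]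

theorem relax_mem_her0 {N r : ℕ} (V : Fin r → Mat N) :
    ∀ X ∈ her0 N, relax V X ∈ her0 N := by
  rintro X ⟨hX, -⟩
  refine (her0 N).smul_mem _ ((her0 N).sum_mem fun k _ => ⟨?_, ?_⟩)
  · change (_ : Mat N)ᴴ = _
    simp only [conjTranspose_sub, conjTranspose_add, conjTranspose_mul, conjTranspose_smul,
      conjTranspose_conjTranspose, hX.eq, star_trivial, Matrix.mul_assoc]
    abel
  · rw [trace_sub, trace_add, trace_smul, trace_mul_comm X, trace_mul_comm (V k * X),
      ← Matrix.mul_assoc, two_smul, sub_self]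

/-- `i ad_H` as an element of `gl(her₀(N))`. -/
def iad0 {N : ℕ} (H : Mat N) (hH : H.IsHermitian) : Module.End ℝ (her0 N) :=
  (iad H).restrict (iad_mem_her0 hH)

/-- `Γ_L` restricted to `her₀(N)`, as an element of `gl(her₀(N))`. -/
def relax0 {N r : ℕ} (V : Fin r → Mat N) : Module.End ℝ (her0 N) :=
  (relax V).restrict (relax_mem_her0 V)

/-- A controlled open Markovian system: drift Hamiltonian, control Hamiltonians
(Hermitian and traceless) and arbitrary Lindblad operators. -/
structure System (N m r : ℕ) where
  Hd : Mat N
  H : Fin m → Mat N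
  V : Fin r → Mat N
  Hd_herm : Hd.IsHermitian
  H_herm : ∀ j, (H j).IsHermitian
  Hd_trace : Hd.trace = 0
  H_trace : ∀ j, (H j).trace = 0

namespace System

variable {N m r : ℕ} (S : System N m r)

/-- `H_u = H_d + ∑ⱼ uⱼ Hⱼ`. -/
def Hu (u : Fin m → ℝ) : Mat N := S.Hd + ∑ j, u j • S.H j

theorem Hu_herm (u : Fin m → ℝ) : (S.Hu u).IsHermitian := by
  change (S.Hd + ∑ j, u j • S.H j)ᴴ = S.Hd + ∑ j, u j • S.H j
  rw [conjTranspose_add, conjTranspose_sum, S.Hd_herm.eq]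
  congr 1
  refine Finset.sum_congr rfl fun j _ => ?_
  rw [conjTranspose_smul, star_trivial, (S.H_herm j).eq]

/-- `i ad_{H_u} + Γ_L` on all matrices. -/
def gen (u : Fin m → ℝ) : Mat N →ₗ[ℝ] Mat N := iad (S.Hu u) + relax S.V

/-- `i ad_{H_u} + Γ_L` as an element of `gl(her₀(N))`. -/
def gen0 (u : Fin m → ℝ) : Module.End ℝ (her0 N) := iad0 (S.Hu u) (S.Hu_herm u) + relax0 S.V

/-- `𝔨_c`, the Lie algebra generated by the control terms. -/
def kc : LieSubalgebra ℝ (Mat N) :=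
  LieSubalgebra.lieSpan ℝ (Mat N) (Set.range fun j => I • S.H j)

/-- `𝔨_d`, the Lie algebra generated by the Hamiltonian drift and the control terms; this is
the dynamic Lie algebra of the closed system, without relaxation. -/
def kd : LieSubalgebra ℝ (Mat N) :=
  LieSubalgebra.lieSpan ℝ (Mat N) (insert (I • S.Hd) (Set.range fun j => I • S.H j))

/-- The dynamic Lie algebra of the open system. -/
def sOpen : LieSubalgebra ℝ (Module.End ℝ (her0 N)) :=
  LieSubalgebra.lieSpan ℝ (Module.End ℝ (her0 N))
    (insert (iad0 S.Hd S.Hd_herm + relax0 S.V) (Set.range fun j => iad0 (S.H j) (S.H_herm j)))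

/-- Full controllability in the absence of relaxation. -/
def FullyControllable : Prop := S.kd = su N

/-- Hamiltonian-controllability. Control amplitudes are never bounded in what follows. -/
def HControllable : Prop := S.kc = su N

/-- Weak Hamiltonian-controllability with relaxation rate `γ`. -/
def WHControllable (γ : ℝ) : Prop := S.kd = su N ∧ 0 ≤ γ ∧ relax0 S.V = γ • 1

end System

/-- The traceless form `C - (tr C / N) 1` of an observable. -/
def tl {N : ℕ} (C : Mat N) : Mat N := C - (C.trace / (N : ℂ)) • (1 : Mat N)

theorem tl_mem_her0 {N : ℕ} {C : Mat N} (hC : C.IsHermitian) : tl C ∈ her0 N := by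
  have htr : star C.trace = C.trace := by rw [← trace_conjTranspose, hC.eq]
  refine ⟨?_, ?_⟩
  · change (C - (C.trace / (N : ℂ)) • (1 : Mat N))ᴴ = C - (C.trace / (N : ℂ)) • (1 : Mat N)
    rw [conjTranspose_sub, conjTranspose_smul, conjTranspose_one, hC.eq, star_div₀, htr,
      star_natCast]
  · rcases Nat.eq_zero_or_pos N with h | h
    · subst h
      exact trace_fin_zero _
    · have : (N : ℂ) ≠ 0 := Nat.cast_ne_zero.2 h.ne'
      simp [tl, trace_sub, trace_smul, trace_one, this]

/-- `ad_𝔨^j span{i C̃}`: the span of the `j`-fold brackets of elements of `𝔨` with `i C̃`. -/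
def adPow {N : ℕ} (k : LieSubalgebra ℝ (Mat N)) (C : Mat N) : ℕ → Submodule ℝ (Mat N)
  | 0 => Submodule.span ℝ {I • tl C}
  | j + 1 => Submodule.span ℝ {Z | ∃ K ∈ k, ∃ X ∈ adPow k C j, Z = ⁅K, X⁆}

/-- Observability space `𝒱_C = ∑ⱼ ad_𝔨^j span{i C̃}` of a closed system with dynamic Lie
algebra `𝔨`. -/
def closedObs {N : ℕ} (k : LieSubalgebra ℝ (Mat N)) (C : Mat N) : Submodule ℝ (Mat N) :=
  ⨆ j, adPow k C j

/-- `u` is piecewise continuous on `[0, T]`: away from finitely many break points it is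
continuous, with finite one-sided limits at the break points. -/
def PiecewiseCont {m : ℕ} (T : ℝ) (u : ℝ → Fin m → ℝ) : Prop :=
  ∃ B : Finset ℝ, ∀ a b : ℝ, 0 ≤ a → a < b → b ≤ T → Disjoint (Set.Ioo a b) (B : Set ℝ) →
    ∃ v : ℝ → Fin m → ℝ, Continuous v ∧ Set.EqOn u v (Set.Ioo a b)

/-- `X : [0, T] → Mat N` is continuous and satisfies `dX/dt = W` (entrywise) away from finitely
many times. -/
def SolvesOn {N : ℕ} (T : ℝ) (X W : ℝ → Mat N) : Prop :=
  ∀ i j, ContinuousOn (fun t => X t i j) (Set.Icc 0 T) ∧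
    ∃ B : Finset ℝ, ∀ t ∈ Set.Ioo 0 T, t ∉ B → HasDerivAt (fun s => X s i j) (W t i j) t

namespace System

variable {N m r : ℕ} (S : System N m r)

/-- `F` is the quantum map on `[0, T]` generated by the control `u`, on traceless Hermitian
matrices: `dF/dt = -(i ad_{H_u} + Γ_L) ∘ F` and `F(0) = 1`. -/
def IsPropagator (T : ℝ) (u : ℝ → Fin m → ℝ) (F : ℝ → Module.End ℝ (her0 N)) : Prop :=
  F 0 = 1 ∧ ∀ X : her0 N,
    SolvesOn T (fun t => (F t X : Mat N)) (fun t => -(S.gen0 (u t) (F t X) : Mat N))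

/-- The quantum maps on `her₀(N)` that can be reached at time exactly `T`. -/
def reach (T : ℝ) : Set (Module.End ℝ (her0 N)) :=
  {P | ∃ u F, PiecewiseCont T u ∧ S.IsPropagator T u F ∧ F T = P}

/-- The Heisenberg-picture maps for a measurement at time `T`: the adjoints of the
reachable quantum maps for the Hilbert-Schmidt scalar product. -/
def heis (T : ℝ) : Set (Module.End ℝ (her0 N)) :=
  {Φ | ∃ P ∈ S.reach T, ∀ X Y : her0 N,
    ((Φ X : Mat N) * (Y : Mat N)).trace = ((X : Mat N) * (P Y : Mat N)).trace}

/-- The Heisenberg-picture maps for measurements at times in `[0, T]`. -/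
def heisUpTo (T : ℝ) : Set (Module.End ℝ (her0 N)) := ⋃ t ∈ Set.Icc (0 : ℝ) T, S.heis t

/-- The span of the traceless observables `i C̃` propagated by a set of Heisenberg-picture maps. -/
def spanOf {N : ℕ} (𝓗 : Set (Module.End ℝ (her0 N))) {C : Mat N} (hC : C.IsHermitian) :
    Submodule ℝ (Mat N) :=
  Submodule.span ℝ ((fun Φ => I • (Φ ⟨tl C, tl_mem_her0 hC⟩ : Mat N)) '' 𝓗)

/-- Observability space of the open system for measurements of `C` at time exactly `T`. -/
def obsAt {C : Mat N} (hC : C.IsHermitian) (T : ℝ) : Submodule ℝ (Mat N) := spanOf (S.heis T) hC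

/-- Observability space of the open system for measurements of `C` at times in `[0, T]`. -/
def obsUpTo {C : Mat N} (hC : C.IsHermitian) (T : ℝ) : Submodule ℝ (Mat N) :=
  spanOf (S.heisUpTo T) hC

/-- Observability space of the open system, for measurements of `C` at arbitrary times. -/
def obs {C : Mat N} (hC : C.IsHermitian) : Submodule ℝ (Mat N) :=
  ⨆ T ∈ Set.Ici (0 : ℝ), S.obsAt hC T

/-- `ρ` solves the controlled master equation `dρ/dt = -(i ad_{H_u} + Γ_L)(ρ)`, `ρ(0) = ρ₀`,
on `[0, T]`. -/
def IsTrajectory (T : ℝ) (u : ℝ → Fin m → ℝ) (ρ₀ : Mat N) (ρ : ℝ → Mat N) : Prop :=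
  ρ 0 = ρ₀ ∧ SolvesOn T ρ (fun t => -S.gen (u t) (ρ t))

/-- Two initial states give the same output `tr(C† ρ(t))` under every control at every time
in `[0, T]`. -/
def Indistinguishable (C : Mat N) (T : ℝ) (ρA ρB : Mat N) : Prop :=
  ∀ u, PiecewiseCont T u → ∀ ρ σ, S.IsTrajectory T u ρA ρ → S.IsTrajectory T u ρB σ →
    ∀ t ∈ Set.Icc 0 T, (Cᴴ * ρ t).trace = (Cᴴ * σ t).trace

/-- The operators reached at time exactly `T` by the closed system `dU/dt = -i H_u U`,
`U(0) = 1`. -/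
def closedReach (T : ℝ) : Set (Mat N) :=
  {P | ∃ (u : ℝ → Fin m → ℝ) (U : ℝ → Mat N), PiecewiseCont T u ∧ U 0 = 1 ∧
    SolvesOn T U (fun t => -(I • (S.Hu (u t) * U t))) ∧ U T = P}

end System

/-- Density operators. -/
def IsDensity {N : ℕ} (ρ : Mat N) : Prop := ρ.PosSemidef ∧ ρ.trace = 1

end OpenQ

end

/-! The observability spaces at exact times are carried forward by Heisenberg maps: concatenating
controls gives `Φ * Ψ ∈ S.heis (s + t)` for `Φ ∈ S.heis s`, `Ψ ∈ S.heis t`. A constant control `u`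
contributes the invertible flow of `A_u = adj N (-S.gen0 u)`, which embeds the space at time `T`
into the space at time `s + T`. The dimension is therefore nondecreasing, hence constant on some
`(0, T₀]`, and there each flow maps one space onto the next. Differentiating `exp(-s A_v) exp(s
A_u)` at `s = 0` shows that `A_u - A_v` preserves every such space. Drift and relaxation cancel in
this difference, so all `i H_j` lie in the stabilizer (`exists_stabilizer`).

If the `i H_j` generate `su(N)`, irreducibility of `her₀(N)` makes the spaces full at small times,
and monotonicity of the dimension does so at all later ones. If relaxation is a multiple of the
identity, a second differentiation shows that the stabilizer is also normalized by `i H_d`. It is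
then an ideal of `𝔨_d = su(N)`, and simplicity (`su_le_of_ideal`) makes it everything. The same
simplicity settles the closed system.

Strict growth of the reachable sets is Liouville's formula: each map reached at time `t` has
determinant `exp(-t tr Γ_L)`, and `tr Γ_L = N ∑ₖ ‖tl Vₖ‖²` is positive as soon as `Γ_L ≠ 0`. So the
determinant reveals the time. This trace formula also gives density of the condition `Γ_L ≠ 0`.

If the open system generates `gl(her₀(N))`, the increasing spans of the Heisenberg maps have
constant dimension near zero. They are then stable under left multiplication by all `A_u`; since
they contain `1`, they are all of `gl(her₀(N))`. -/

noncomputable section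

open Set Filter Topology
open scoped NNReal

namespace OpenQ

/-! ### Linear differential equations with piecewise continuous coefficients -/

section LinearODE

variable {E Y Z : Type*} [NormedAddCommGroup E] [NormedSpace ℝ E]
  [TopologicalSpace Y] [TopologicalSpace Z]

/-- `f` is piecewise continuous on `[a, b]`. -/
def PiecewiseContOn (a b : ℝ) (f : ℝ → Y) : Prop :=
  ∃ B : Finset ℝ, ∀ c d : ℝ, a ≤ c → c < d → d ≤ b → Disjoint (Ioo c d) (B : Set ℝ) →
    ∃ v : ℝ → Y, Continuous v ∧ EqOn f v (Ioo c d)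

theorem PiecewiseContOn.mono {a b c d : ℝ} {f : ℝ → Y} (h : PiecewiseContOn a b f)
    (hac : a ≤ c) (hdb : d ≤ b) : PiecewiseContOn c d f := by
  obtain ⟨B, hB⟩ := h
  exact ⟨B, fun c' d' h1 h2 h3 => hB c' d' (hac.trans h1) h2 (h3.trans hdb)⟩

theorem PiecewiseContOn.comp {a b : ℝ} {f : ℝ → Y} (h : PiecewiseContOn a b f) {g : Y → Z}
    (hg : Continuous g) : PiecewiseContOn a b (fun t => g (f t)) := by
  obtain ⟨B, hB⟩ := h
  refine ⟨B, fun c d h1 h2 h3 h4 => ?_⟩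
  obtain ⟨v, hv, hfv⟩ := hB c d h1 h2 h3 h4
  exact ⟨fun t => g (v t), hg.comp hv, fun t ht => congrArg g (hfv ht)⟩

theorem Continuous.piecewiseContOn {a b : ℝ} {f : ℝ → Y} (h : Continuous f) :
    PiecewiseContOn a b f :=
  ⟨∅, fun _ _ _ _ _ _ => ⟨f, h, fun _ _ => rfl⟩⟩

/-- Concatenation of two piecewise continuous functions. -/
theorem PiecewiseContOn.concat {s t : ℝ} {f g : ℝ → Y} (hf : PiecewiseContOn 0 s f)
    (hg : PiecewiseContOn 0 t g) :
    PiecewiseContOn 0 (s + t) (fun τ => if τ ≤ s then f τ else g (τ - s)) := by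
  classical
  obtain ⟨B, hB⟩ := hf
  obtain ⟨D, hD⟩ := hg
  refine ⟨insert s (B ∪ D.image (· + s)), fun c d h1 h2 h3 h4 => ?_⟩
  have hs : s ∉ Ioo c d := fun h =>
    Set.disjoint_left.1 h4 h (Finset.mem_coe.2 (Finset.mem_insert_self _ _))
  by_cases hds : d ≤ s
  · obtain ⟨v, hv, hfv⟩ := hB c d h1 h2 hds (h4.mono_right fun x hx => by
      simp only [Finset.coe_insert, Finset.coe_union]; exact Or.inr (Or.inl hx))
    refine ⟨v, hv, fun τ hτ => ?_⟩
    simp only [if_pos (hτ.2.le.trans hds)]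
    exact hfv hτ
  · have hsc : s ≤ c := by
      by_contra h
      exact hs ⟨not_le.1 h, not_le.1 hds⟩
    obtain ⟨v, hv, hfv⟩ := hD (c - s) (d - s) (by linarith) (by linarith) (by linarith) (by
      rw [Set.disjoint_left] at h4 ⊢
      intro x hx hxD
      refine h4 (a := x + s) ⟨by linarith [hx.1], by linarith [hx.2]⟩ ?_
      simp only [Finset.coe_insert, Finset.coe_union, Finset.coe_image]
      exact Or.inr (Or.inr ⟨x, hxD, rfl⟩))
    refine ⟨fun τ => v (τ - s), by fun_prop, fun τ hτ => ?_⟩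
    simp only [if_neg (not_le.2 (hsc.trans_lt hτ.1))]
    exact hfv ⟨by linarith [hτ.1], by linarith [hτ.2]⟩

/-- `x` is continuous on `[a, b]` and `x' = A x` there, apart from finitely many times. -/
def LinSol (A : ℝ → E →L[ℝ] E) (a b : ℝ) (x : ℝ → E) : Prop :=
  ContinuousOn x (Icc a b) ∧
    ∃ B : Finset ℝ, ∀ t ∈ Ioo a b, t ∉ B → HasDerivAt x (A t (x t)) t

theorem LinSol.mono {A : ℝ → E →L[ℝ] E} {a b c d : ℝ} {x : ℝ → E} (h : LinSol A a b x)
    (hac : a ≤ c) (hdb : d ≤ b) : LinSol A c d x :=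
  ⟨h.1.mono (Icc_subset_Icc hac hdb), h.2.imp fun _ hB t ht =>
    hB t (Ioo_subset_Ioo hac hdb ht)⟩

theorem LinSol.congr {A A' : ℝ → E →L[ℝ] E} {a b : ℝ} {x : ℝ → E} (h : LinSol A a b x)
    (hA : EqOn A A' (Ioo a b)) : LinSol A' a b x :=
  ⟨h.1, h.2.imp fun _ hB t ht hn => by simpa only [hA ht] using hB t ht hn⟩

theorem LinSol.concat {A : ℝ → E →L[ℝ] E} {a b c : ℝ} {x y : ℝ → E} (hab : a ≤ b) (hbc : b ≤ c)
    (hx : LinSol A a b x) (hy : LinSol A b c y) (hxy : x b = y b) :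
    LinSol A a c (fun t => if t ≤ b then x t else y t) := by
  classical
  obtain ⟨hxc, B, hB⟩ := hx
  obtain ⟨hyc, D, hD⟩ := hy
  refine ⟨?_, insert b (B ∪ D), fun t ht htn => ?_⟩
  · rw [← Icc_union_Icc_eq_Icc hab hbc]
    refine ContinuousOn.union_of_isClosed ?_ ?_ isClosed_Icc isClosed_Icc
    · exact hxc.congr fun t ht => if_pos ht.2
    · refine hyc.congr fun t ht => ?_
      rcases ht.1.eq_or_lt with h | h
      · subst h; simp [hxy]
      · exact if_neg (not_le.2 h)
  · simp only [Finset.mem_insert, Finset.mem_union, not_or] at htn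
    rcases lt_or_gt_of_ne htn.1 with h | h
    · simp only [if_pos h.le]
      refine (hB t ⟨ht.1, h⟩ htn.2.1).congr_of_eventuallyEq ?_
      filter_upwards [gt_mem_nhds h] with s hs
      exact if_pos hs.le
    · simp only [if_neg (not_le.2 h)]
      refine (hD t ⟨h, ht.2⟩ htn.2.2).congr_of_eventuallyEq ?_
      filter_upwards [lt_mem_nhds h] with s hs
      exact if_neg (not_le.2 hs)

/-- The fundamental theorem of calculus tolerates countably many exceptional points. Every
conservation law below (inverse propagators, unitarity, determinants) is an instance. -/
theorem eq_of_hasDerivAt_zero_off_finset [CompleteSpace E] {f : ℝ → E} {a b : ℝ} (hab : a ≤ b)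
    (hc : ContinuousOn f (Icc a b)) {B : Finset ℝ}
    (hd : ∀ t ∈ Ioo a b, t ∉ B → HasDerivAt f 0 t) : f b = f a := by
  have := MeasureTheory.integral_eq_of_hasDerivAt_off_countable_of_le f (fun _ => 0) hab
    (s := (B : Set ℝ)) B.countable_toSet hc (fun t ht => hd t ht.1 ht.2) (by simp)
  simp only [intervalIntegral.integral_zero] at this
  exact (sub_eq_zero.1 this.symm)

/-- On the ball of radius `‖x₀‖` about `x₀` the field is bounded by `2 M ‖x₀‖`, so Picard–Lindelöf
applies for times up to `1 / (2 M)`. This length does not depend on `x₀`. -/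
theorem exists_linSol_of_short [CompleteSpace E] {A : ℝ → E →L[ℝ] E} (hA : Continuous A)
    {a b M : ℝ} (hab : a ≤ b) (hM : 0 ≤ M) (hAM : ∀ t ∈ Icc a b, ‖A t‖ ≤ M)
    (hMb : 2 * M * (b - a) ≤ 1) (x₀ : E) : ∃ x, x a = x₀ ∧ LinSol A a b x := by
  lift M to ℝ≥0 using hM
  let R : ℝ≥0 := ‖x₀‖₊
  have hR : (R : ℝ) = ‖x₀‖ := rfl
  have hpl : IsPicardLindelof (fun t x => A t x) (tmin := a) (tmax := b) ⟨a, le_rfl, hab⟩ x₀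
      R 0 (M * (2 * R)) M := by
    refine ⟨fun t ht => ?_, fun x _ => ?_, fun t ht x hx => ?_, ?_⟩
    · refine ((A t).lipschitz.weaken ?_).lipschitzOnWith
      exact hAM t ht
    · exact (hA.clm_apply continuous_const).continuousOn
    · have hx' : ‖x‖ ≤ 2 * R := by
        have h1 : ‖x - x₀‖ ≤ R := by simpa [dist_eq_norm] using hx
        have h2 := norm_add_le (x - x₀) x₀
        rw [sub_add_cancel] at h2
        linarith
      push_cast
      exact ((A t).le_opNorm x).trans (mul_le_mul (hAM t ht) hx' (norm_nonneg _) M.2)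
    · simp only [sub_self, NNReal.coe_zero, sub_zero, max_eq_left (sub_nonneg.2 hab)]
      push_cast
      nlinarith [R.2]
  obtain ⟨x, hx0, hx⟩ := hpl.exists_eq_forall_mem_Icc_hasDerivWithinAt₀
  exact ⟨x, hx0, fun t ht => (hx t ht).continuousWithinAt, ∅, fun t ht _ =>
    (hx t (Ioo_subset_Icc_self ht)).hasDerivAt (Icc_mem_nhds ht.1 ht.2)⟩

/-- The admissible step is the same for every initial value, so finitely many short solutions can be
glued; the induction counts steps of length `1 / (2 M)`. -/
theorem exists_linSol_of_continuous [CompleteSpace E] {A : ℝ → E →L[ℝ] E} (hA : Continuous A)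
    {a b : ℝ} (hab : a ≤ b) (x₀ : E) : ∃ x, x a = x₀ ∧ LinSol A a b x := by
  obtain ⟨M, hM⟩ := isCompact_Icc.exists_bound_of_continuousOn (s := Icc a b) hA.continuousOn
  have hM0 : 0 ≤ M := (norm_nonneg _).trans (hM a ⟨le_rfl, hab⟩)
  have key : ∀ n : ℕ, ∀ c : ℝ, a ≤ c → c ≤ b → 2 * M * (c - a) ≤ n →
      ∃ x, x a = x₀ ∧ LinSol A a c x := by
    intro n
    induction n with
    | zero =>
      intro c hac hcb h
      exact exists_linSol_of_short hA hac hM0 (fun t ht => hM t ⟨ht.1, ht.2.trans hcb⟩)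
        (h.trans (by norm_num)) x₀
    | succ n ih =>
      intro c hac hcb h
      by_cases hn : 2 * M * (c - a) ≤ n
      · exact ih c hac hcb hn
      · have hMpos : 0 < M := by
          rcases hM0.eq_or_lt with h0 | h0
          · subst h0; simp at hn
          · exact h0
        push Not at hn
        push_cast at h
        have hd : 2 * M * (a + n / (2 * M) - a) = n := by field_simp; ring
        have had : a ≤ a + n / (2 * M) := by
          have : (0 : ℝ) ≤ n / (2 * M) := by positivity
          linarith
        have hdc : a + n / (2 * M) ≤ c := by
          by_contra hlt
          push Not at hlt
          nlinarith
        obtain ⟨x, hx0, hx⟩ := ih (a + n / (2 * M)) had (hdc.trans hcb) hd.le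
        obtain ⟨y, hy0, hy⟩ := exists_linSol_of_short hA hdc hM0
          (fun t ht => hM t ⟨had.trans ht.1, ht.2.trans hcb⟩) (by nlinarith)
          (x (a + n / (2 * M)))
        exact ⟨_, by simp only [if_pos had, hx0], hx.concat had hdc hy hy0.symm⟩
  obtain ⟨n, hn⟩ := exists_nat_ge (2 * M * (b - a))
  exact key n b hab le_rfl hn

/-- Linear differential equations with piecewise continuous coefficients have solutions. -/
theorem PiecewiseContOn.exists_linSol [CompleteSpace E] {A : ℝ → E →L[ℝ] E} {a b : ℝ}
    (hA : PiecewiseContOn a b A) (hab : a ≤ b) (x₀ : E) : ∃ x, x a = x₀ ∧ LinSol A a b x := by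
  classical
  obtain ⟨B, hB⟩ := hA
  -- Induction on the number of break points in the open interval: cutting at a break point moves it
  -- to the boundary of both halves.
  have key : ∀ n : ℕ, ∀ c d : ℝ, a ≤ c → c ≤ d → d ≤ b →
      (B.filter (· ∈ Ioo c d)).card ≤ n → ∀ x₀ : E, ∃ x, x c = x₀ ∧ LinSol A c d x := by
    intro n
    induction n with
    | zero =>
      intro c d hac hcd hdb hn x₀
      rcases hcd.eq_or_lt with rfl | hlt
      · exact ⟨fun _ => x₀, rfl, continuousOn_const, ∅, by simp⟩
      · obtain ⟨v, hv, hAv⟩ := hB c d hac hlt hdb (by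
          rw [Set.disjoint_left]
          intro t ht htB
          have := Finset.card_eq_zero.1 (Nat.le_zero.1 hn)
          exact Finset.notMem_empty t (this ▸ Finset.mem_filter.2 ⟨htB, ht⟩))
        obtain ⟨x, hx0, hx⟩ := exists_linSol_of_continuous hv hcd x₀
        exact ⟨x, hx0, hx.congr hAv.symm⟩
    | succ n ih =>
      intro c d hac hcd hdb hn x₀
      by_cases hne : (B.filter (· ∈ Ioo c d)).Nonempty
      · obtain ⟨e, he⟩ := hne
        have he' := (Finset.mem_filter.1 he).2
        have hlt : ∀ p q : ℝ, c ≤ p → q ≤ d → e ∉ Ioo p q →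
            (B.filter (· ∈ Ioo p q)).card ≤ n := fun p q hp hq hpq => by
          refine Nat.le_of_lt_succ ((Finset.card_lt_card ?_).trans_le hn)
          refine (Finset.ssubset_iff_of_subset fun t ht => ?_).2 ⟨e, he, fun h => hpq
            (Finset.mem_filter.1 h).2⟩
          have := Finset.mem_filter.1 ht
          exact Finset.mem_filter.2 ⟨this.1, Ioo_subset_Ioo hp hq this.2⟩
        obtain ⟨x, hx0, hx⟩ := ih c e hac he'.1.le (he'.2.le.trans hdb)
          (hlt c e le_rfl he'.2.le (fun h => lt_irrefl _ h.2)) x₀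
        obtain ⟨y, hy0, hy⟩ := ih e d (hac.trans he'.1.le) he'.2.le hdb
          (hlt e d he'.1.le le_rfl (fun h => lt_irrefl _ h.1)) (x e)
        exact ⟨_, by simp only [if_pos he'.1.le, hx0], hx.concat he'.1.le he'.2.le hy hy0.symm⟩
      · rw [Finset.not_nonempty_iff_eq_empty] at hne
        exact ih c d hac hcd hdb (by rw [hne]; simp) x₀
  exact key _ a b le_rfl hab le_rfl le_rfl x₀

/-- The fundamental solution of a linear differential equation with piecewise continuous
coefficients. -/
theorem PiecewiseContOn.exists_fundamental [FiniteDimensional ℝ E] {A : ℝ → E →L[ℝ] E} {T : ℝ}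
    (hA : PiecewiseContOn 0 T A) (hT : 0 ≤ T) :
    ∃ F : ℝ → E →L[ℝ] E, F 0 = 1 ∧ ContinuousOn F (Icc 0 T) ∧
      (∃ B : Finset ℝ, ∀ t ∈ Ioo 0 T, t ∉ B → HasDerivAt F (A t * F t) t) ∧
      (∀ t ∈ Icc 0 T, Function.Injective (F t)) ∧
      ∀ x, LinSol A 0 T x → ∀ t ∈ Icc 0 T, x t = F t (x 0) := by
  classical
  have : CompleteSpace E := FiniteDimensional.complete ℝ E
  obtain ⟨F, hF0, hFc, BF, hBF⟩ := (hA.comp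
    (ContinuousLinearMap.mul ℝ (E →L[ℝ] E)).continuous).exists_linSol hT 1
  -- `G` solves `G' = -G A`, so `G x` is constant along every solution `x`. Applied to the columns
  -- of `F` this gives `G F = 1`; finite dimension then makes `G` injective, which yields
  -- uniqueness.
  obtain ⟨G, hG0, hGc, BG, hBG⟩ := (hA.comp
    (-(ContinuousLinearMap.mul ℝ (E →L[ℝ] E)).flip).continuous).exists_linSol hT 1
  have hG : ∀ x, LinSol A 0 T x → ∀ t ∈ Icc 0 T, G t (x t) = x 0 := by
    rintro x ⟨hxc, B, hB⟩ t ht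
    have := eq_of_hasDerivAt_zero_off_finset (f := fun t => G t (x t)) ht.1 (B := BG ∪ B)
      ((hGc.clm_apply hxc).mono (Icc_subset_Icc_right ht.2)) (fun s hs hsn => by
        have hs' : s ∈ Ioo 0 T := ⟨hs.1, hs.2.trans_le ht.2⟩
        simp only [Finset.mem_union, not_or] at hsn
        refine ((hBG s hs' hsn.1).clm_apply (hB s hs' hsn.2)).congr_deriv ?_
        simp)
    simp only [hG0] at this
    simpa using this
  have hGF : ∀ t ∈ Icc 0 T, ∀ e, G t (F t e) = e := fun t ht e => by
    simpa [hF0] using hG (fun t => F t e) ⟨hFc.clm_apply continuousOn_const, BF,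
      fun s hs hsn => by simpa using (hBF s hs hsn).clm_apply (hasDerivAt_const s e)⟩ t ht
  refine ⟨F, hF0, hFc, ⟨BF, hBF⟩, fun t ht => Function.LeftInverse.injective (hGF t ht),
    fun x hx t ht => ?_⟩
  have hinj : Function.Injective (G t) :=
    (LinearMap.injective_iff_surjective (f := (G t : E →ₗ[ℝ] E))).2 fun e => ⟨F t e, hGF t ht e⟩
  exact hinj (by rw [hG x hx t ht, hGF t ht])

theorem LinSol.eq_of_eq [FiniteDimensional ℝ E] {A : ℝ → E →L[ℝ] E} {T : ℝ}
    (hA : PiecewiseContOn 0 T A) {x y : ℝ → E} (hx : LinSol A 0 T x) (hy : LinSol A 0 T y)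
    (h0 : x 0 = y 0) {t : ℝ} (ht : t ∈ Icc 0 T) : x t = y t := by
  obtain ⟨F, -, -, -, -, hF⟩ := hA.exists_fundamental (ht.1.trans ht.2)
  rw [hF x hx t ht, hF y hy t ht, h0]

end LinearODE

end OpenQ

end

noncomputable section

open Set Filter Topology

namespace OpenQ

/-! ### Families of subspaces transported by flows -/

section Invariance

variable {E : Type*} [NormedAddCommGroup E] [NormedSpace ℝ E] [FiniteDimensional ℝ E]

/-- A derivative at `0` lies in each subspace that contains the curve for small positive times. -/
theorem deriv_mem_of_mem (W : Submodule ℝ E) {f : ℝ → E} {f' : E} (hf : HasDerivAt f f' 0)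
    {ε : ℝ} (hε : 0 < ε) (hW : ∀ s, 0 ≤ s → s < ε → f s ∈ W) : f' ∈ W := by
  have h := hasDerivWithinAt_iff_tendsto_slope.1 (hf.hasDerivWithinAt (s := Ici 0))
  rw [Ici_sdiff_left] at h
  have hcl : IsClosed (W : Set E) := W.closed_of_finiteDimensional
  refine hcl.mem_of_tendsto h ?_
  filter_upwards [Ioo_mem_nhdsGT hε] with s hs
  rw [slope_def_module]
  exact W.smul_mem _ (W.sub_mem (hW s hs.1.le hs.2) (hW 0 le_rfl hε))

/-- A set of natural numbers has a least element; where it is attained, monotonicity forbids smaller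
values at earlier times. -/
theorem exists_const_near_zero {d : ℝ → ℕ} (hd : ∀ s t, 0 < s → s ≤ t → d s ≤ d t) :
    ∃ T > 0, ∀ t, 0 < t → t ≤ T → d t = d T := by
  have hne : (d '' Ioi 0).Nonempty := ⟨_, 1, mem_Ioi.2 one_pos, rfl⟩
  obtain ⟨T, hT, hTm⟩ := Nat.sInf_mem hne
  refine ⟨T, hT, fun t ht htT => le_antisymm (hd t T ht htT) ?_⟩
  rw [hTm]
  exact Nat.sInf_le ⟨t, ht, rfl⟩

/-- The flow `exp (s A)` of an endomorphism. -/
def flow (s : ℝ) (A : Module.End ℝ E) : Module.End ℝ E :=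
  (NormedSpace.exp (s • LinearMap.toContinuousLinearMap A) : E →L[ℝ] E)

theorem flow_zero (A : Module.End ℝ E) : flow 0 A = 1 := by
  simp [flow]

theorem hasDerivAt_exp_clm (A : E →L[ℝ] E) (s : ℝ) :
    HasDerivAt (fun s : ℝ => NormedSpace.exp (s • A)) (A * NormedSpace.exp (s • A)) s := by
  have : CompleteSpace E := FiniteDimensional.complete ℝ E
  exact hasDerivAt_exp_smul_const' A s

theorem hasDerivAt_flow (A : Module.End ℝ E) {f : ℝ → E} {f' : E} {s : ℝ}
    (hf : HasDerivAt f f' s) :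
    HasDerivAt (fun s => flow s A (f s)) (A (flow s A (f s)) + flow s A f') s :=
  (hasDerivAt_exp_clm (LinearMap.toContinuousLinearMap A) s).clm_apply hf

theorem flow_neg_apply_flow (s : ℝ) (A : Module.End ℝ E) (x : E) :
    flow (-s) A (flow s A x) = x := by
  have : CompleteSpace E := FiniteDimensional.complete ℝ E
  let _ : NormedAlgebra ℚ (E →L[ℝ] E) := .restrictScalars ℚ ℝ _
  let a := LinearMap.toContinuousLinearMap A
  have h : NormedSpace.exp (-s • a) * NormedSpace.exp (s • a) = 1 := by
    rw [← NormedSpace.exp_add_of_commute ((Commute.refl a).smul_left _ |>.smul_right _),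
      neg_smul, neg_add_cancel, NormedSpace.exp_zero]
  exact DFunLike.congr_fun h x

theorem flow_injective (s : ℝ) (A : Module.End ℝ E) : Function.Injective (flow s A) :=
  Function.LeftInverse.injective (flow_neg_apply_flow s A)

/-- Anti-automorphisms commute with the flow. -/
theorem map_flow (σ : Module.End ℝ E →ₗ[ℝ] Module.End ℝ E) (h1 : σ 1 = 1)
    (hmul : ∀ A B, σ (A * B) = σ B * σ A) (s : ℝ) (A : Module.End ℝ E) :
    σ (flow s A) = flow s (σ A) := by
  have : CompleteSpace E := FiniteDimensional.complete ℝ E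
  let c : Module.End ℝ E ≃ₗ[ℝ] (E →L[ℝ] E) := LinearMap.toContinuousLinearMap
  -- Into the opposite algebra, `σ` becomes a continuous ring homomorphism, and such maps commute
  -- with the exponential.
  let g : (E →L[ℝ] E) →ₗ[ℝ] (E →L[ℝ] E)ᵐᵒᵖ :=
    (MulOpposite.opLinearEquiv ℝ).toLinearMap ∘ₗ c.toLinearMap ∘ₗ σ ∘ₗ c.symm.toLinearMap
  let f : (E →L[ℝ] E) →+* (E →L[ℝ] E)ᵐᵒᵖ :=
    { g with
      map_one' := by
        change MulOpposite.op (c (σ 1)) = 1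
        rw [h1]; rfl
      map_zero' := map_zero g
      map_mul' := fun x y => by
        change MulOpposite.op (c (σ (c.symm x * c.symm y))) = _
        rw [hmul]; rfl }
  let _ : NormedAlgebra ℚ (E →L[ℝ] E) := .restrictScalars ℚ ℝ _
  have hf : Continuous f := g.continuous_of_finiteDimensional
  have h := NormedSpace.map_exp f hf (s • c A)
  have h2 : f (s • c A) = MulOpposite.op (s • c (σ A)) := by
    change g (s • c A) = _
    rw [map_smul]
    rfl
  rw [h2, NormedSpace.exp_op] at h
  have h3 := MulOpposite.op_injective h
  exact c.injective h3

/-- If the flows of the `A i` map `V T` into `V (s + T)`, then for small `T` the spaces `V T` are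
invariant under `A i - A j`, and the endomorphisms which leave them invariant are stable under
commutators with the `A i`. -/
theorem exists_invariant_near_zero {ι : Type*} [Nonempty ι] (A : ι → Module.End ℝ E)
    (V : ℝ → Submodule ℝ E)
    (hV : ∀ i s T, 0 ≤ s → 0 < T → ∀ x ∈ V T, flow s (A i) x ∈ V (s + T)) :
    ∃ T₀ > 0, (∀ i j, ∀ T ∈ Ioo 0 T₀, ∀ x ∈ V T, A i x - A j x ∈ V T) ∧
      ∀ i (B : Module.End ℝ E), (∀ T ∈ Ioo 0 T₀, ∀ x ∈ V T, B x ∈ V T) →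
        ∀ T ∈ Ioo 0 T₀, ∀ x ∈ V T, A i (B x) - B (A i x) ∈ V T := by
  obtain ⟨i₀⟩ := ‹Nonempty ι›
  have hle : ∀ i s T, 0 ≤ s → 0 < T → (V T).map (flow s (A i)) ≤ V (s + T) :=
    fun i s T hs hT => Submodule.map_le_iff_le_comap.2 (hV i s T hs hT)
  have hdim : ∀ i s T, Module.finrank ℝ ((V T).map (flow s (A i))) = Module.finrank ℝ (V T) :=
    fun i s T => (Submodule.equivMapOfInjective _ (flow_injective s (A i)) (V T)).finrank_eq.symm
  -- Injective flows make the dimension monotone; up to `T₀` it is constant, so inclusions become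
  -- equalities and the flows can be inverted between the spaces.
  obtain ⟨T₀, hT₀, hconst⟩ := exists_const_near_zero (d := fun T => Module.finrank ℝ (V T))
    (fun s t hs hst => by
      have := Submodule.finrank_mono (hle i₀ (t - s) s (sub_nonneg.2 hst) hs)
      rwa [hdim, sub_add_cancel] at this)
  have heq : ∀ i s T, 0 ≤ s → 0 < T → s + T ≤ T₀ → (V T).map (flow s (A i)) = V (s + T) :=
    fun i s T hs hT hsT => Submodule.eq_of_le_of_finrank_eq (hle i s T hs hT) (by
      rw [hdim, hconst T hT (by linarith), hconst (s + T) (by linarith) hsT])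
  have hback : ∀ i s T, 0 ≤ s → 0 < T → s + T ≤ T₀ → ∀ x ∈ V (s + T),
      flow (-s) (A i) x ∈ V T := fun i s T hs hT hsT x hx => by
    rw [← heq i s T hs hT hsT] at hx
    obtain ⟨y, hy, rfl⟩ := hx
    rwa [flow_neg_apply_flow]
  have hneg : ∀ i (f : ℝ → E) (f' : E), HasDerivAt f f' 0 →
      HasDerivAt (fun s => flow (-s) (A i) (f s)) (f' - A i (f 0)) 0 := fun i f f' hf => by
    let a := LinearMap.toContinuousLinearMap (A i)
    have h := (hasDerivAt_exp_clm (-a) 0).clm_apply hf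
    refine (h.congr_deriv ?_).congr_of_eventuallyEq (Eventually.of_forall fun s => ?_)
    · simp [a, sub_eq_neg_add]
    · change NormedSpace.exp (-s • a) (f s) = NormedSpace.exp (s • -a) (f s)
      rw [smul_neg, neg_smul]
  refine ⟨T₀, hT₀, fun i j T hT x hx => ?_, fun i B hB T hT x hx => ?_⟩
  -- Forward with `A i` and back with `A j` is a curve inside `V T`, with derivative `A i x - A j x`
  -- at `0`.
  · refine deriv_mem_of_mem (V T) (f := fun s => flow (-s) (A j) (flow s (A i) x)) ?_
      (sub_pos.2 hT.2) fun s hs hsT => hback j s T hs hT.1 (by linarith) _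
        (hV i s T hs hT.1 x hx)
    have h := hneg j _ _ (hasDerivAt_flow (A i) (hasDerivAt_const (0 : ℝ) x))
    simpa [flow_zero] using h
  -- Conjugating `B` by the flow needs `B` to preserve the intermediate space `V (s + T)`; this is
  -- why invariance is assumed for all small times at once.
  · have key : B (A i x) - A i (B x) ∈ V T := by
      refine deriv_mem_of_mem (V T) (f := fun s => flow (-s) (A i) (B (flow s (A i) x))) ?_
        (sub_pos.2 hT.2) fun s hs hsT => hback i s T hs hT.1 (by linarith) _
          (hB _ ⟨by linarith [hT.1], by linarith⟩ _ (hV i s T hs hT.1 x hx))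
      have h1 := hasDerivAt_flow (A i) (hasDerivAt_const (0 : ℝ) x)
      have h2 := (LinearMap.toContinuousLinearMap B).hasFDerivAt.comp_hasDerivAt (0 : ℝ) h1
      have h := hneg i _ _ h2
      simpa [flow_zero] using h
    rw [← neg_sub] at key
    exact (V T).neg_mem_iff.1 key

theorem mul_mem_of_flow_mul_mem (W : Submodule ℝ (Module.End ℝ E)) (A X : Module.End ℝ E)
    {ε : ℝ} (hε : 0 < ε) (hW : ∀ s, 0 ≤ s → s < ε → flow s A * X ∈ W) : A * X ∈ W := by
  let c : Module.End ℝ E ≃ₗ[ℝ] (E →L[ℝ] E) := LinearMap.toContinuousLinearMap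
  have h := deriv_mem_of_mem (W.map c.toLinearMap)
    (f := fun s => NormedSpace.exp (s • c A) * c X)
    ((hasDerivAt_exp_clm (c A) 0).mul_const (c X)) hε
    fun s hs hsε => ⟨flow s A * X, hW s hs hsε, rfl⟩
  obtain ⟨Y, hY, hYe⟩ := h
  have : Y = A * X := c.injective (hYe.trans (by simp; rfl))
  rwa [← this]

/-- If the spaces `V T` grow with `T` and left multiplication by the flows of the `A i` maps `V T`
into `V (s + T)`, then for small `T` the spaces `V T` are stable under left multiplication by the
`A i`. -/
theorem exists_mul_mem_near_zero {ι : Type*} (A : ι → Module.End ℝ E)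
    (V : ℝ → Submodule ℝ (Module.End ℝ E)) (hmono : ∀ s t, s ≤ t → V s ≤ V t)
    (hV : ∀ i s T, 0 ≤ s → 0 < T → ∀ X ∈ V T, flow s (A i) * X ∈ V (s + T)) :
    ∃ T₀ > 0, ∀ T, 0 < T → T ≤ T₀ → ∀ i, ∀ X ∈ V T, A i * X ∈ V T := by
  obtain ⟨T₀, hT₀, hconst⟩ := exists_const_near_zero (d := fun T => Module.finrank ℝ (V T))
    (fun s t _ hst => Submodule.finrank_mono (hmono s t hst))
  have heq : ∀ T, 0 < T → T ≤ T₀ → V T = V T₀ := fun T hT hTT =>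
    Submodule.eq_of_le_of_finrank_eq (hmono _ _ hTT) (hconst T hT hTT)
  refine ⟨T₀, hT₀, fun T hT hTT i X hX => ?_⟩
  refine mul_mem_of_flow_mul_mem _ _ _ (half_pos hT₀) fun s hs hsT => ?_
  -- All spaces on `(0, T₀]` coincide, so `X` may be regarded as lying at time `T₀ / 2`; this leaves
  -- room for flow times `s < T₀ / 2`, even when `T = T₀`.
  rw [heq T hT hTT] at hX ⊢
  rw [← heq (T₀ / 2) (by linarith) (by linarith)] at hX
  have := hV i s _ hs (half_pos hT₀) X hX
  rwa [heq _ (by linarith) (by linarith)] at this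

end Invariance

/-! ### Generators of the full linear Lie algebra -/

section LieSpan

variable {M : Type*} [AddCommGroup M] [Module ℝ M]

/-- Let `σ` be a surjective anti-homomorphism of `gl(M)`. If `σ` of each element of a generating
set of the Lie algebra `gl(M)` leaves `W ∋ 1` invariant under left multiplication, then `W` is
all of `gl(M)`. -/
theorem eq_top_of_lieSpan_eq_top {σ : Module.End ℝ M →ₗ[ℝ] Module.End ℝ M}
    (hmul : ∀ A B, σ (A * B) = σ B * σ A) (hσ : Function.Surjective σ)
    {s : Set (Module.End ℝ M)} (hs : LieSubalgebra.lieSpan ℝ (Module.End ℝ M) s = ⊤)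
    {W : Submodule ℝ (Module.End ℝ M)} (h1 : 1 ∈ W) (hW : ∀ A ∈ s, ∀ X ∈ W, σ A * X ∈ W) :
    W = ⊤ := by
  -- Reversing products only flips the sign of a bracket, so these operators still form a Lie
  -- algebra. Evaluating at `1 ∈ W` afterwards puts the whole range of `σ` into `W`.
  let 𝔤 : LieSubalgebra ℝ (Module.End ℝ M) :=
    { carrier := {B | ∀ X ∈ W, σ B * X ∈ W}
      add_mem' := fun {A B} hA hB X hX => by
        rw [map_add, add_mul]; exact W.add_mem (hA X hX) (hB X hX)
      zero_mem' := fun X _ => by rw [map_zero, zero_mul]; exact W.zero_mem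
      smul_mem' := fun c A hA X hX => by
        rw [map_smul, smul_mul_assoc]; exact W.smul_mem _ (hA X hX)
      lie_mem' := fun {A B} hA hB X hX => by
        rw [Ring.lie_def, map_sub, hmul, hmul, sub_mul, mul_assoc, mul_assoc]
        exact W.sub_mem (hB _ (hA X hX)) (hA _ (hB X hX)) }
  have hle : LieSubalgebra.lieSpan ℝ (Module.End ℝ M) s ≤ 𝔤 := LieSubalgebra.lieSpan_le.2 hW
  refine top_le_iff.1 fun B _ => ?_
  obtain ⟨A, rfl⟩ := hσ B
  have hA : A ∈ 𝔤 := hle (hs ▸ LieSubalgebra.mem_top A)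
  simpa using hA 1 h1

/-- If `gl(M)` is generated by elements which are skew for an anti-homomorphism, then `M` is
trivial. -/
theorem eq_zero_of_lieSpan_skew_eq_top {σ : Module.End ℝ M →ₗ[ℝ] Module.End ℝ M} (h1 : σ 1 = 1)
    (hmul : ∀ A B, σ (A * B) = σ B * σ A) {s : Set (Module.End ℝ M)}
    (hs : LieSubalgebra.lieSpan ℝ (Module.End ℝ M) s = ⊤) (hskew : ∀ A ∈ s, σ A = -A) (x : M) :
    x = 0 := by
  let 𝔤 : LieSubalgebra ℝ (Module.End ℝ M) :=
    { carrier := {B | σ B = -B}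
      add_mem' := fun {A B} hA hB => by
        change σ (A + B) = -(A + B)
        rw [map_add, show σ A = _ from hA, show σ B = _ from hB, neg_add]
      zero_mem' := by simp
      smul_mem' := fun c A hA => by
        change σ (c • A) = -(c • A)
        rw [map_smul, show σ A = _ from hA, smul_neg]
      lie_mem' := fun {A B} hA hB => by
        change σ ⁅A, B⁆ = -⁅A, B⁆
        rw [Ring.lie_def, map_sub, hmul, hmul, show σ A = _ from hA, show σ B = _ from hB, neg_mul_neg,
          neg_mul_neg, neg_sub] }
  have hle : LieSubalgebra.lieSpan ℝ (Module.End ℝ M) s ≤ 𝔤 := LieSubalgebra.lieSpan_le.2 hskew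
  have h2 : σ 1 = -1 := (hle (hs ▸ LieSubalgebra.mem_top 1) : (1 : Module.End ℝ M) ∈ 𝔤)
  rw [h1] at h2
  have h3 : x = -x := congrArg (fun P : Module.End ℝ M => P x) h2
  have h4 : (2 : ℝ) • x = 0 := by
    rw [two_smul]
    exact add_eq_zero_iff_eq_neg.2 h3
  exact (smul_eq_zero.1 h4).resolve_left two_ne_zero

end LieSpan

end OpenQ

end

noncomputable section

open Set Matrix Complex

namespace OpenQ

/-! ### Simplicity of `su(N)` and irreducibility of `her₀(N)` -/

section Simplicity

variable {N : ℕ}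

/-- With `E = single i j 1`, bracketing twice gives `-2 X j i • E`, which handles a nonzero
off-diagonal entry. A diagonal nonscalar `X` has two distinct diagonal entries, and one bracket
gives `(X j j - X i i) • E`. -/
theorem single_mem_of_commutator_mem {Z : Submodule ℂ (Mat N)}
    (hZ : ∀ M, ∀ X ∈ Z, M * X - X * M ∈ Z) {X : Mat N} (hX : X ∈ Z)
    (hX1 : ∀ c : ℂ, X ≠ c • 1) : ∃ i j, i ≠ j ∧ single i j 1 ∈ Z := by
  by_cases hoff : ∃ i j, i ≠ j ∧ X j i ≠ 0
  · obtain ⟨i, j, hij, hXji⟩ := hoff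
    refine ⟨i, j, hij, ?_⟩
    have h := hZ (single i j 1) _ (hZ (single i j 1) _ hX)
    have hEE : (single i j 1 : Mat N) * single i j 1 = 0 := by
      rw [single_mul_single_of_ne _ _ _ _ hij.symm]
    have hEXE : (single i j 1 : Mat N) * X * single i j 1 = X j i • single i j 1 := by
      rw [single_mul_mul_single]; simp
    have : (single i j 1 : Mat N) * (single i j 1 * X - X * single i j 1)
        - (single i j 1 * X - X * single i j 1) * single i j 1
        = (-2 * X j i) • single i j 1 := by
      rw [mul_sub, sub_mul, ← mul_assoc, ← mul_assoc, hEE, hEXE, mul_assoc X, hEE, zero_mul,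
        mul_zero, mul_smul]
      module
    rw [this] at h
    exact (Z.smul_mem_iff (mul_ne_zero (by norm_num) hXji)).1 h
  · push Not at hoff
    have hdiag : X = diagonal fun k => X k k := by
      ext k l
      by_cases hkl : k = l
      · subst hkl; simp
      · rw [diagonal_apply_ne _ hkl, hoff l k (Ne.symm hkl)]
    have hne : ∃ i j, X i i ≠ X j j := by
      by_contra hall
      push Not at hall
      rcases isEmpty_or_nonempty (Fin N) with h | ⟨⟨i₀⟩⟩
      · exact hX1 0 (Subsingleton.elim _ _)
      · refine hX1 (X i₀ i₀) ?_
        rw [hdiag, smul_one_eq_diagonal]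
        congr 1
        funext k
        simp [hall k i₀]
    obtain ⟨i, j, hd⟩ := hne
    have hij : i ≠ j := fun h => hd (by rw [h])
    refine ⟨i, j, hij, ?_⟩
    have h := hZ (single i j 1) _ hX
    have : (single i j 1 : Mat N) * X - X * single i j 1 = (X j j - X i i) • single i j 1 := by
      ext k l
      have hk : ∀ k l, k ≠ l → X k l = 0 := fun k l hkl => hoff l k hkl.symm
      rw [Matrix.sub_apply, Matrix.smul_apply, smul_eq_mul, single_apply]
      by_cases hki : i = k
      · subst hki
        rw [single_mul_apply_same, one_mul]
        by_cases hlj : j = l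
        · subst hlj
          rw [mul_single_apply_same]; simp
        · rw [mul_single_apply_of_ne _ _ _ _ _ (Ne.symm hlj), hk j l hlj]; simp [hlj]
      · rw [single_mul_apply_of_ne _ _ _ _ _ (Ne.symm hki)]
        by_cases hlj : j = l
        · subst hlj
          rw [mul_single_apply_same, hk k i (Ne.symm hki)]; simp [hki]
        · rw [mul_single_apply_of_ne _ _ _ _ _ (Ne.symm hlj)]; simp [hki]
    rw [this] at h
    exact (Z.smul_mem_iff (sub_ne_zero.2 hd.symm)).1 h

/-- A complex subspace of matrices which is stable under commutators and contains a nonscalar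
matrix contains each traceless matrix. -/
theorem mem_of_commutator_mem {Z : Submodule ℂ (Mat N)}
    (hZ : ∀ M, ∀ X ∈ Z, M * X - X * M ∈ Z) {X : Mat N} (hX : X ∈ Z)
    (hX1 : ∀ c : ℂ, X ≠ c • 1) {Y : Mat N} (hY : Y.trace = 0) : Y ∈ Z := by
  obtain ⟨i, j, hij, hE⟩ := single_mem_of_commutator_mem hZ hX hX1
  -- From one matrix unit, brackets reach the rest of row `i`, then column `i`, then all
  -- off-diagonal units and the differences of diagonal ones.
  have hrow : ∀ l, l ≠ i → (single i l 1 : Mat N) ∈ Z := fun l hl => by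
    have h := hZ (single j l 1) _ hE
    rw [single_mul_single_of_ne _ _ _ _ hl, single_mul_single_same, zero_sub, mul_one] at h
    exact Z.neg_mem_iff.1 h
  have hcol : ∀ k, k ≠ i → (single k i 1 : Mat N) ∈ Z := fun k hk => by
    have h := hZ (single k i 1) _ (hZ (single k i 1) _ (hrow k hk))
    have : (single k i 1 : Mat N) * (single k i 1 * single i k 1 - single i k 1 * single k i 1)
        - (single k i 1 * single i k 1 - single i k 1 * single k i 1) * single k i 1
        = (-2 : ℂ) • single k i 1 := by
      simp only [single_mul_single_same, mul_sub, sub_mul, mul_one,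
        single_mul_single_of_ne _ _ _ _ hk.symm]
      module
    rw [this] at h
    exact (Z.smul_mem_iff (by norm_num)).1 h
  have hoff : ∀ k l, k ≠ l → (single k l 1 : Mat N) ∈ Z := fun k l hkl => by
    by_cases hl : l = i
    · subst hl; exact hcol k hkl
    · have h := hZ (single k i 1) _ (hrow l hl)
      rwa [single_mul_single_same, single_mul_single_of_ne _ _ _ _ hkl.symm, sub_zero,
        mul_one] at h
  have hdiag : ∀ k, (single k k 1 - single i i 1 : Mat N) ∈ Z := fun k => by
    by_cases hk : k = i
    · subst hk; rw [sub_self]; exact Z.zero_mem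
    · have h := hZ (single k i 1) _ (hrow k hk)
      rwa [single_mul_single_same, single_mul_single_same, mul_one] at h
  -- Subtracting `single i i 1` from every diagonal unit costs nothing because the trace of `Y`
  -- vanishes.
  have hsum : Y = ∑ k, ∑ l, Y k l • (single k l 1 - if k = l then single i i 1 else 0 : Mat N) := by
    simp only [smul_sub, Finset.sum_sub_distrib, smul_ite, smul_zero, Finset.sum_ite_eq,
      Finset.mem_univ, if_true, ← Finset.sum_smul]
    have ht : ∑ k, Y k k = 0 := hY
    rw [ht, zero_smul, sub_zero]
    conv_lhs => rw [matrix_eq_sum_single Y]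
    simp
  rw [hsum]
  refine Z.sum_mem fun k _ => Z.sum_mem fun l _ => Z.smul_mem _ ?_
  by_cases hkl : k = l
  · subst hkl; simpa using hdiag k
  · simpa [hkl] using hoff k l hkl

/-- The skew-Hermitian part of a matrix. -/
def skew : Mat N →ₗ[ℝ] Mat N where
  toFun X := (1 / 2 : ℝ) • (X - Xᴴ)
  map_add' X Y := by rw [conjTranspose_add, ← smul_add]; congr 1; abel
  map_smul' c X := by
    rw [conjTranspose_smul, star_trivial, ← smul_sub, smul_comm, RingHom.id_apply]

theorem skew_apply (X : Mat N) : skew X = (1 / 2 : ℝ) • (X - Xᴴ) := rfl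

theorem skew_conjTranspose (X : Mat N) : (skew X)ᴴ = -skew X := by
  rw [skew_apply, conjTranspose_smul, conjTranspose_sub, conjTranspose_conjTranspose, star_trivial,
    ← smul_neg, neg_sub]

theorem skew_of_skew {X : Mat N} (h : Xᴴ = -X) : skew X = X := by
  rw [skew_apply, h]; module

theorem skew_of_isHermitian {X : Mat N} (h : X.IsHermitian) : skew X = 0 := by
  rw [skew_apply, h.eq]; simp

theorem skew_smul (c : ℂ) (X : Mat N) : skew (c • X) = c.re • skew X + c.im • skew (I • X) := by
  conv_lhs => rw [← re_add_im c]
  rw [add_smul, map_add, mul_smul, Complex.coe_smul, Complex.coe_smul, map_smul, map_smul]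

theorem skew_commutator {K : Mat N} (hK : Kᴴ = -K) (X : Mat N) :
    skew (K * X - X * K) = K * skew X - skew X * K := by
  simp only [skew_apply, conjTranspose_sub, conjTranspose_mul, hK, mul_smul_comm, smul_mul_assoc,
    ← smul_sub]
  congr 1
  noncomm_ring

theorem trace_tl (X : Mat N) : (tl X).trace = 0 := by
  rcases Nat.eq_zero_or_pos N with h | h
  · subst h
    exact trace_fin_zero _
  · have : (N : ℂ) ≠ 0 := Nat.cast_ne_zero.2 h.ne'
    simp [tl, trace_sub, trace_smul, trace_one, this]

theorem skew_mem_su {X : Mat N} (h : X.trace = 0) : skew X ∈ su N :=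
  ⟨skew_conjTranspose X, by simp [skew_apply, trace_smul, trace_sub, trace_conjTranspose, h]⟩

theorem eq_zero_of_scalar_of_trace {X : Mat N} {c : ℂ} (h : X = c • 1) (ht : X.trace = 0) :
    X = 0 := by
  rcases Nat.eq_zero_or_pos N with hN | hN
  · subst hN; exact Subsingleton.elim _ _
  · rw [h, trace_smul, trace_one, Fintype.card_fin, smul_eq_mul, mul_eq_zero] at ht
    rcases ht with ht | ht
    · rw [h, ht, zero_smul]
    · exact absurd ht (Nat.cast_ne_zero.2 hN.ne')

/-- The Cartesian decomposition; with it, statements about brackets with `su(N)` extend to brackets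
with all matrices. -/
theorem eq_skew_add (X : Mat N) : X = skew X + I • skew (-I • X) := by
  have h : I • ((-I • X) - (-I • X)ᴴ) = X + Xᴴ := by
    rw [conjTranspose_smul, smul_sub, smul_smul, smul_smul]
    simp
  rw [skew_apply, skew_apply, smul_comm I (1 / 2 : ℝ), h]
  module

theorem commutator_eq_tl (M X : Mat N) : M * X - X * M = tl M * X - X * tl M := by
  simp only [tl, sub_mul, mul_sub, smul_mul_assoc, mul_smul_comm, one_mul, mul_one]
  abel

/-- A matrix commuting with `su(N)` is scalar. -/
theorem eq_smul_one_of_commute_su {X : Mat N} (h : ∀ K ∈ su N, K * X = X * K) :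
    ∃ c : ℂ, X = c • 1 := by
  have hall : ∀ M : Mat N, M * X = X * M := fun M => by
    rw [← sub_eq_zero, commutator_eq_tl, eq_skew_add (tl M), add_mul, mul_add, smul_mul_assoc,
      mul_smul_comm, h _ (skew_mem_su (trace_tl M)),
      h _ (skew_mem_su (by rw [trace_smul, trace_tl, smul_zero])), sub_self]
  have : X ∈ Set.center (Mat N) := Semigroup.mem_center_iff.2 hall
  rw [Matrix.center_eq_range] at this
  obtain ⟨c, rfl⟩ := this
  exact ⟨c, by simp [smul_one_eq_diagonal]⟩

/-- `su(N)` has no proper nonzero ideals. -/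
theorem su_le_of_ideal {W : Submodule ℝ (Mat N)} (hW : W ≤ (su N).toSubmodule)
    (hid : ∀ K ∈ su N, ∀ X ∈ W, ⁅K, X⁆ ∈ W) (hne : W ≠ ⊥) : W = (su N).toSubmodule := by
  refine le_antisymm hW fun Y hY => ?_
  -- `Z` is the largest complex subspace whose skew-Hermitian parts lie in `W`. It inherits
  -- stability under commutators and contains `W`, since `i X` is Hermitian for `X ∈ W`; the complex
  -- statement then applies, and taking skew parts returns to `W`.
  let Z : Submodule ℂ (Mat N) :=
    { carrier := {X | skew X ∈ W ∧ skew (I • X) ∈ W}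
      add_mem' := fun hA hB => ⟨by rw [map_add]; exact W.add_mem hA.1 hB.1,
        by rw [smul_add, map_add]; exact W.add_mem hA.2 hB.2⟩
      zero_mem' := by simp
      smul_mem' := fun c X hX => by
        have h : ∀ c : ℂ, skew (c • X) ∈ W := fun c => by
          rw [skew_smul]
          exact W.add_mem (W.smul_mem _ hX.1) (W.smul_mem _ hX.2)
        exact ⟨h c, by rw [smul_smul]; exact h _⟩ }
  have hZsu : ∀ K ∈ su N, ∀ X ∈ Z, K * X - X * K ∈ Z := fun K hK X hX => by
    refine ⟨?_, ?_⟩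
    · rw [skew_commutator hK.1]
      exact hid K hK _ hX.1
    · rw [smul_sub, ← mul_smul_comm, ← smul_mul_assoc, skew_commutator hK.1]
      exact hid K hK _ hX.2
  have hZ : ∀ M, ∀ X ∈ Z, M * X - X * M ∈ Z := fun M X hX => by
    have : M * X - X * M = (skew (tl M) * X - X * skew (tl M))
        + I • (skew (-I • tl M) * X - X * skew (-I • tl M)) := by
      rw [commutator_eq_tl]
      conv_lhs => rw [eq_skew_add (tl M)]
      rw [add_mul, mul_add, smul_mul_assoc, mul_smul_comm, smul_sub]
      abel
    rw [this]
    exact Z.add_mem (hZsu _ (skew_mem_su (trace_tl M)) X hX) (Z.smul_mem _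
      (hZsu _ (skew_mem_su (by rw [trace_smul, trace_tl, smul_zero])) X hX))
  obtain ⟨X, hX, hX0⟩ := W.exists_mem_ne_zero_of_ne_bot hne
  have hXsu : X ∈ su N := hW hX
  have hXZ : X ∈ Z := by
    refine ⟨by rwa [skew_of_skew hXsu.1], ?_⟩
    rw [skew_of_isHermitian]
    · exact W.zero_mem
    · change (I • X)ᴴ = I • X
      rw [conjTranspose_smul, hXsu.1]
      simp
  have hYsu : Y ∈ su N := hY
  have hYZ : Y ∈ Z := mem_of_commutator_mem hZ hXZ
    (fun c hc => hX0 (eq_zero_of_scalar_of_trace hc hXsu.2)) hYsu.2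
  rw [← skew_of_skew hYsu.1]
  exact hYZ.1

/-- Multiplication by `i`, from `her₀(N)` to `su(N)`. -/
def mulI (N : ℕ) : her0 N →ₗ[ℝ] Mat N where
  toFun X := I • (X : Mat N)
  map_add' _ _ := smul_add _ _ _
  map_smul' c X := by rw [RingHom.id_apply, smul_comm c I]; rfl

theorem mulI_apply (X : her0 N) : mulI N X = I • (X : Mat N) := rfl

theorem mulI_injective : Function.Injective (mulI N) := fun _ _ h =>
  Subtype.ext (smul_right_injective _ I_ne_zero h)

theorem I_smul_mem_su {X : Mat N} (hX : X ∈ her0 N) : I • X ∈ su N := by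
  refine ⟨?_, by rw [trace_smul, hX.2, smul_zero]⟩
  rw [conjTranspose_smul, hX.1.eq]
  simp

theorem neg_I_smul_mem_her0 {X : Mat N} (hX : X ∈ su N) : -I • X ∈ her0 N := by
  refine ⟨?_, by rw [trace_smul, hX.2, smul_zero]⟩
  change (-I • X)ᴴ = -I • X
  rw [conjTranspose_smul, hX.1]
  simp

theorem range_mulI : LinearMap.range (mulI N) = (su N).toSubmodule := by
  ext X
  constructor
  · rintro ⟨Y, rfl⟩
    exact I_smul_mem_su Y.2
  · intro hX
    refine ⟨⟨-I • X, neg_I_smul_mem_her0 hX⟩, ?_⟩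
    rw [mulI_apply, smul_smul]
    simp

theorem map_mulI_top : (⊤ : Submodule ℝ (her0 N)).map (mulI N) = (su N).toSubmodule := by
  rw [← LinearMap.range_eq_map, range_mulI]

/-- `her₀(N)` is an irreducible representation of `su(N)`. -/
theorem her0_irreducible {W : Submodule ℝ (her0 N)} (hne : W ≠ ⊥)
    (hW : ∀ (H : Mat N) (hH : H ∈ her0 N), ∀ X ∈ W, iad0 H hH.1 X ∈ W) : W = ⊤ := by
  have h := su_le_of_ideal (W := W.map (mulI N)) ?_ ?_ ?_
  · rw [← map_mulI_top] at h
    exact Submodule.map_injective_of_injective mulI_injective h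
  · rintro _ ⟨X, -, rfl⟩
    exact I_smul_mem_su X.2
  · rintro K hK _ ⟨X, hX, rfl⟩
    refine ⟨_, hW _ (neg_I_smul_mem_her0 hK) X hX, ?_⟩
    change I • I • ((-I • K) * (X : Mat N) - (X : Mat N) * (-I • K)) = K * (I • (X : Mat N)) -
      (I • (X : Mat N)) * K
    simp only [smul_mul_assoc, mul_smul_comm, smul_sub, smul_smul]
    simp
  · intro h
    refine hne (Submodule.map_injective_of_injective mulI_injective ?_)
    rw [h, Submodule.map_bot]

/-- Bracketing with `su(N)` raises the degree `j` by one, so the sum is an ideal; it contains `i C̃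
≠ 0`, and simplicity concludes. -/
theorem closedObs_su {C : Mat N} (hC : C.IsHermitian) (hC0 : tl C ≠ 0) :
    closedObs (su N) C = (su N).toSubmodule := by
  have hmem : ∀ j, adPow (su N) C j ≤ (su N).toSubmodule := by
    intro j
    induction j with
    | zero =>
      refine Submodule.span_le.2 ?_
      rintro _ rfl
      exact I_smul_mem_su (tl_mem_her0 hC)
    | succ j ih =>
      refine Submodule.span_le.2 ?_
      rintro _ ⟨K, hK, X, hX, rfl⟩
      exact (su N).lie_mem hK (ih hX)
  refine su_le_of_ideal (iSup_le hmem) (fun K hK X hX => ?_) ?_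
  · refine Submodule.iSup_induction (adPow (su N) C)
      (motive := fun X => ⁅K, X⁆ ∈ closedObs (su N) C) hX (fun j X hX => ?_) ?_ ?_
    · exact Submodule.mem_iSup_of_mem (j + 1) (Submodule.subset_span ⟨K, hK, X, hX, rfl⟩)
    · rw [lie_zero]; exact Submodule.zero_mem _
    · intro X Y hX hY
      rw [lie_add]; exact Submodule.add_mem _ hX hY
  · intro h
    have h1 : I • tl C ∈ closedObs (su N) C :=
      Submodule.mem_iSup_of_mem 0 (Submodule.subset_span rfl)
    rw [h, Submodule.mem_bot] at h1
    exact hC0 ((smul_eq_zero.1 h1).resolve_left I_ne_zero)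

end Simplicity

/-! ### The Hilbert–Schmidt product and its adjoint -/

section Adjoint

variable {N : ℕ}

/-- The Hilbert-Schmidt scalar product on `her₀(N)`. -/
def hs (N : ℕ) : LinearMap.BilinForm ℝ (her0 N) :=
  LinearMap.mk₂ ℝ (fun X Y => ((X : Mat N) * (Y : Mat N)).trace.re)
    (fun X Y Z => by simp [add_mul]) (fun c X Y => by simp)
    (fun X Y Z => by simp [mul_add]) (fun c X Y => by simp)

/-- The trace of a product of two Hermitian matrices equals its own conjugate by cyclicity, so
taking the real part loses nothing. -/
theorem ofReal_hs (X Y : her0 N) : ((hs N X Y : ℝ) : ℂ) = ((X : Mat N) * (Y : Mat N)).trace := by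
  refine conj_eq_iff_re.1 ?_
  change star _ = _
  rw [← trace_conjTranspose, conjTranspose_mul, X.2.1.eq, Y.2.1.eq, trace_mul_comm]

theorem hs_comm (X Y : her0 N) : hs N X Y = hs N Y X := by
  apply ofReal_injective
  rw [ofReal_hs, ofReal_hs, trace_mul_comm]

theorem hs_self_eq_zero {X : her0 N} (h : hs N X X = 0) : X = 0 := by
  have h1 : ((X : Mat N)ᴴ * (X : Mat N)).trace = 0 := by
    rw [X.2.1.eq, ← ofReal_hs, h, ofReal_zero]
  open scoped ComplexOrder in
  exact Subtype.ext (trace_conjTranspose_mul_self_eq_zero_iff.1 h1)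

theorem hs_nondegenerate : (hs N).Nondegenerate :=
  ⟨fun X h => hs_self_eq_zero (h X), fun X h => hs_self_eq_zero (h X)⟩

theorem hs_ext {X Y : her0 N} (h : ∀ Z, hs N X Z = hs N Y Z) : X = Y := by
  rw [← sub_eq_zero]
  refine hs_self_eq_zero ?_
  rw [LinearMap.BilinForm.sub_left, h, sub_self]

/-- The Hilbert-Schmidt adjoint on `gl(her₀(N))`. -/
def adj (N : ℕ) : Module.End ℝ (her0 N) →ₗ[ℝ] Module.End ℝ (her0 N) where
  toFun P := ((hs N).toDual hs_nondegenerate).symm.toLinearMap ∘ₗ P.dualMap ∘ₗ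
    ((hs N).toDual hs_nondegenerate).toLinearMap
  map_add' P Q := by
    ext1 X
    simp [LinearMap.dualMap, map_add]
  map_smul' c P := by
    ext1 X
    simp [LinearMap.dualMap]

theorem hs_adj (P : Module.End ℝ (her0 N)) (X Y : her0 N) :
    hs N (adj N P X) Y = hs N X (P Y) := by
  change hs N (((hs N).toDual hs_nondegenerate).symm _) Y = _
  rw [LinearMap.BilinForm.apply_toDual_symm_apply]
  rfl

theorem eq_adj {P Q : Module.End ℝ (her0 N)} (h : ∀ X Y, hs N (Q X) Y = hs N X (P Y)) :
    Q = adj N P :=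
  LinearMap.ext fun X => hs_ext fun Z => by rw [h, hs_adj]

theorem adj_adj (P : Module.End ℝ (her0 N)) : adj N (adj N P) = P :=
  (eq_adj fun X Y => by rw [hs_comm, hs_comm X, hs_adj]).symm

theorem adj_one : adj N 1 = 1 :=
  (eq_adj (P := 1) (Q := 1) fun X Y => by simp only [Module.End.one_apply]).symm

theorem adj_mul (P Q : Module.End ℝ (her0 N)) : adj N (P * Q) = adj N Q * adj N P :=
  (eq_adj fun X Y => by rw [Module.End.mul_apply, hs_adj, hs_adj]; rfl).symm

theorem adj_neg_apply (P : Module.End ℝ (her0 N)) (X : her0 N) :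
    adj N (-P) X = -(adj N P X) := hs_ext fun Z => by
  rw [hs_adj, LinearMap.BilinForm.neg_left, hs_adj]
  exact LinearMap.BilinForm.neg_right _ _

theorem adj_injective : Function.Injective (adj N) :=
  Function.LeftInverse.injective adj_adj

theorem adj_surjective : Function.Surjective (adj N) :=
  Function.RightInverse.surjective adj_adj

theorem isUnit_adj {P : Module.End ℝ (her0 N)} (h : IsUnit P) : IsUnit (adj N P) := by
  obtain ⟨⟨P, Q, hPQ, hQP⟩, rfl⟩ := h
  exact ⟨⟨adj N P, adj N Q, by rw [← adj_mul, hQP, adj_one], by rw [← adj_mul, hPQ, adj_one]⟩, rfl⟩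

theorem adj_iad0 {H : Mat N} (hH : H.IsHermitian) : adj N (iad0 H hH) = -iad0 H hH := by
  refine (eq_adj fun X Y => ofReal_injective ?_).symm
  rw [ofReal_hs, ofReal_hs]
  change (-(I • (H * (X : Mat N) - (X : Mat N) * H)) * (Y : Mat N)).trace
    = ((X : Mat N) * (I • (H * (Y : Mat N) - (Y : Mat N) * H))).trace
  simp only [neg_mul, smul_mul_assoc, mul_smul_comm, sub_mul, mul_sub, trace_neg, trace_smul,
    trace_sub]
  rw [mul_assoc H, trace_mul_comm H, mul_assoc, mul_assoc, ← smul_neg, neg_sub]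

end Adjoint

end OpenQ

end

noncomputable section

open Set Matrix Complex

namespace OpenQ

/-! ### Jacobi's and Liouville's formulas for determinants -/

section Liouville

/-- The product rule replaces one row of `M` at a time by a row of `A * M`. That row is a
combination of the rows of `M`, and only the term `A i i` survives in the determinant. The field is
general because both real propagators and complex unitaries need it. -/
theorem hasDerivAt_det {n 𝔽 : Type*} [Fintype n] [DecidableEq n] [NormedField 𝔽] [NormedAlgebra ℝ 𝔽]
    {M : ℝ → Matrix n n 𝔽} {A : Matrix n n 𝔽} {t : ℝ}
    (h : ∀ i j, HasDerivAt (fun s => M s i j) ((A * M t) i j) t) :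
    HasDerivAt (fun s => (M s).det) (A.trace * (M t).det) t := by
  have hrow : ∀ i, ((M t).updateRow i ((A * M t) i)).det = A i i * (M t).det := fun i => by
    rw [← smul_eq_mul (A i i), ← det_updateRow_sum (M t) i (A i)]
    congr 2
    funext j
    simp [mul_apply]
  have hdet : ∀ X : Matrix n n 𝔽, X.det = ∑ σ : Equiv.Perm n, (σ.sign : ℤ) • ∏ i, X i (σ i) :=
    fun X => by
      rw [← det_transpose, det_apply]
      rfl
  have hd : HasDerivAt (fun s => (M s).det)
      (∑ σ : Equiv.Perm n, (σ.sign : ℤ) •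
        ∑ i, (∏ j ∈ Finset.univ.erase i, M t j (σ j)) • (A * M t) i (σ i)) t := by
    simp_rw [hdet]
    refine HasDerivAt.fun_sum fun σ _ => ?_
    have := HasDerivAt.fun_finsetProd (u := Finset.univ) (fun i _ => h i (σ i))
    rcases Int.units_eq_one_or σ.sign with hs | hs
    · simpa [hs] using this
    · simpa [hs] using this.fun_neg
  refine hd.congr_deriv ?_
  simp only [trace, diag_apply, Finset.sum_mul, ← hrow]
  simp_rw [hdet, Finset.smul_sum]
  rw [Finset.sum_comm]
  refine Finset.sum_congr rfl fun i _ => Finset.sum_congr rfl fun σ _ => ?_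
  congr 1
  rw [← Finset.mul_prod_erase Finset.univ _ (Finset.mem_univ i), updateRow_self, smul_eq_mul,
    mul_comm]
  congr 1
  refine Finset.prod_congr rfl fun j hj => ?_
  rw [updateRow_ne (Finset.ne_of_mem_erase hj)]

variable {E : Type*} [NormedAddCommGroup E] [NormedSpace ℝ E] [FiniteDimensional ℝ E]

theorem hasDerivAt_det_clm {F : ℝ → E →L[ℝ] E} {A : E →L[ℝ] E} {t : ℝ}
    (h : HasDerivAt F (A * F t) t) :
    HasDerivAt (fun s => (F s).det) (LinearMap.trace ℝ E A * (F t).det) t := by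
  let b := Module.finBasis ℝ E
  have h1 := hasDerivAt_det (M := fun s => LinearMap.toMatrix b b (F s : E →ₗ[ℝ] E))
    (A := LinearMap.toMatrix b b (A : E →ₗ[ℝ] E)) (t := t) (fun i j => by
      rw [← LinearMap.toMatrix_mul]
      simp only [LinearMap.toMatrix_apply]
      exact (LinearMap.toContinuousLinearMap (b.coord i)).hasFDerivAt.comp_hasDerivAt t
        (h.clm_apply (hasDerivAt_const t (b j))) |>.congr_deriv (by simp))
  simp only [LinearMap.det_toMatrix] at h1
  rw [LinearMap.trace_eq_matrix_trace ℝ b]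
  exact h1

/-- The quantity `exp(-t τ) det F(t)` is conserved. -/
theorem det_fundamental {F : ℝ → E →L[ℝ] E} {A : ℝ → E →L[ℝ] E} {T τ : ℝ} (hT : 0 ≤ T)
    (h0 : F 0 = 1) (hc : ContinuousOn F (Icc 0 T)) {B : Finset ℝ}
    (hd : ∀ t ∈ Ioo 0 T, t ∉ B → HasDerivAt F (A t * F t) t)
    (hτ : ∀ t, LinearMap.trace ℝ E (A t) = τ) : (F T).det = Real.exp (T * τ) := by
  have h := eq_of_hasDerivAt_zero_off_finset (f := fun t => Real.exp (-(t * τ)) * (F t).det)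
    (B := B) hT ?_ ?_
  · simp only [h0, zero_mul, neg_zero, Real.exp_zero, one_mul] at h
    rw [Real.exp_neg, inv_mul_eq_div, div_eq_iff (Real.exp_ne_zero _)] at h
    rw [h]
    simp [ContinuousLinearMap.det]
  · exact ContinuousOn.mul (by fun_prop) (ContinuousLinearMap.continuous_det.comp_continuousOn hc)
  · intro t ht htB
    have h1 : HasDerivAt (fun t => Real.exp (-(t * τ))) (Real.exp (-(t * τ)) * (-τ)) t := by
      have : HasDerivAt (fun t : ℝ => -(t * τ)) (-τ) t := by
        simpa using ((hasDerivAt_id' t).mul_const τ).fun_neg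
      exact this.exp
    refine (h1.mul (hasDerivAt_det_clm (hd t ht htB))).congr_deriv ?_
    rw [hτ]; ring

end Liouville

/-! ### The trace of the relaxation operator -/

section Trace

variable {N : ℕ}

/-- The map `X ↦ A X B`. -/
def sandwich (A B : Mat N) : Mat N →ₗ[ℝ] Mat N := LinearMap.mulLeftRight ℝ (A, B)

theorem sandwich_apply (A B X : Mat N) : sandwich A B X = A * X * B := by
  simp [sandwich]

/-- The complex trace of `X ↦ A X B` is `tr A · tr B`; passing to real scalars takes twice the real
part. -/
theorem trace_sandwich (A B : Mat N) :
    LinearMap.trace ℝ (Mat N) (sandwich A B) = 2 * (A.trace * B.trace).re := by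
  classical
  let b := Complex.basisOneI.smulTower (Matrix.stdBasis ℂ (Fin N) (Fin N))
  have hb : ∀ k i j, LinearMap.toMatrix b b (sandwich A B) (k, (i, j)) (k, (i, j)) =
      (A i i * B j j).re := by
    intro k i j
    have hr : ∀ X : Mat N, (Matrix.stdBasis ℂ (Fin N) (Fin N)).repr X (i, j) = X i j :=
      fun X => rfl
    rw [LinearMap.toMatrix_apply, Module.Basis.smulTower_apply, Module.Basis.smulTower_repr,
      stdBasis_eq_single, sandwich_apply, smul_single, hr]
    have : (A * single i j (Complex.basisOneI k • (1 : ℂ)) * B) i j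
        = A i i * Complex.basisOneI k * B j j := by
      simp [mul_apply, single_apply, ite_and]
    rw [this, Complex.coe_basisOneI_repr]
    fin_cases k <;> (simp; try ring)
  rw [LinearMap.trace_eq_matrix_trace ℝ b, Matrix.trace]
  simp only [diag_apply, Fintype.sum_prod_type, hb]
  simp only [Fin.sum_univ_two, ← two_mul]
  rw [Matrix.trace, Matrix.trace, Finset.sum_mul_sum, re_sum]
  simp only [re_sum, diag_apply]

/-- The traceless Hermitian part of a matrix. -/
def toHer0 (N : ℕ) : Mat N →ₗ[ℝ] her0 N where
  toFun X := ⟨-I • skew (I • tl X), neg_I_smul_mem_her0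
    (skew_mem_su (by rw [trace_smul, trace_tl, smul_zero]))⟩
  map_add' X Y := Subtype.ext <| by
    have : tl (X + Y) = tl X + tl Y := by
      simp only [tl, trace_add, add_div, add_smul]; abel
    simp only [this, smul_add, map_add, Submodule.coe_add]
  map_smul' c X := Subtype.ext <| by
    have : tl (c • X) = c • tl X := by
      simp only [tl, trace_smul, smul_sub, smul_div_assoc, smul_assoc]
    simp only [this, smul_comm _ c, map_smul, RingHom.id_apply, Submodule.coe_smul]

theorem coe_toHer0 (X : Mat N) : (toHer0 N X : Mat N) = (1 / 2 : ℝ) • (tl X + (tl X)ᴴ) := by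
  change -I • skew (I • tl X) = _
  rw [skew_apply, smul_comm (-I) (1 / 2 : ℝ), conjTranspose_smul, smul_sub, smul_smul, smul_smul]
  simp

theorem toHer0_coe (X : her0 N) : toHer0 N (X : Mat N) = X := by
  apply Subtype.ext
  have : tl (X : Mat N) = X := by simp [tl, X.2.2]
  rw [coe_toHer0, this, X.2.1.eq]
  module

/-- The trace on `her₀(N)` of a complex linear, Hermiticity preserving map with traceless
values. -/
theorem trace_restrict_her0 (L : Mat N →ₗ[ℝ] Mat N) (hI : ∀ X, L (I • X) = I • L X)
    (ht : ∀ X, (L X).trace = 0) (hher : ∀ X ∈ her0 N, L X ∈ her0 N) :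
    LinearMap.trace ℝ (her0 N) (L.restrict hher) = LinearMap.trace ℝ (Mat N) L / 2 := by
  have hc : ∀ (c : ℂ) X, L (c • X) = c • L X := fun c X => by
    conv_lhs => rw [← re_add_im c]
    conv_rhs => rw [← re_add_im c]
    simp only [add_smul, map_add, mul_smul, Complex.coe_smul, map_smul, hI]
  let J : Mat N →ₗ[ℝ] Mat N :=
    { toFun := fun X => I • X
      map_add' := fun X Y => smul_add _ _ _
      map_smul' := fun c X => smul_comm _ _ _ }
  have hJJ : J ∘ₗ J = -LinearMap.id := by ext1 X; simp [J, smul_smul]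
  -- `L` after the projection to `her₀(N)` is half the sum of `L`, a correction for the scalar part,
  -- and the conjugate-linear `Q`. Since `Q` anticommutes with multiplication by `i`, its real trace
  -- is zero.
  let Q : Mat N →ₗ[ℝ] Mat N :=
    { toFun := fun X => L ((tl X)ᴴ)
      map_add' := fun X Y => by
        rw [← map_add, ← conjTranspose_add]
        congr 2
        simp only [tl, trace_add, add_div, add_smul]; abel
      map_smul' := fun c X => by
        rw [RingHom.id_apply, ← map_smul]
        congr 1
        rw [show tl (c • X) = c • tl X by
          simp only [tl, trace_smul, smul_sub, smul_div_assoc, smul_assoc],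
          conjTranspose_smul, star_trivial] }
  have hQJ : Q ∘ₗ J = -(J ∘ₗ Q) := by
    ext1 X
    change L ((tl (I • X))ᴴ) = -(I • L ((tl X)ᴴ))
    rw [show tl (I • X) = I • tl X by
          simp only [tl, trace_smul, smul_sub, smul_div_assoc, smul_assoc],
          conjTranspose_smul, hc]
    simp
  have hQ : LinearMap.trace ℝ (Mat N) Q = 0 := by
    have h1 : LinearMap.trace ℝ (Mat N) ((Q ∘ₗ J) ∘ₗ J) = LinearMap.trace ℝ (Mat N) (J ∘ₗ (Q ∘ₗ J)) :=
      LinearMap.trace_comp_comm' _ _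
    have h2 : (Q ∘ₗ J) ∘ₗ J = -Q := by
      rw [LinearMap.comp_assoc, hJJ]
      exact LinearMap.ext fun X => map_neg Q X
    have h3 : J ∘ₗ (Q ∘ₗ J) = Q := by
      rw [hQJ]
      refine LinearMap.ext fun X => ?_
      change J (-J (Q X)) = Q X
      rw [map_neg]
      simp [J, smul_smul]
    rw [h2, h3, map_neg] at h1
    linarith
  -- The scalar correction factors through the matrix trace, and the reversed composition vanishes
  -- because `L 1` is traceless.
  let f : ℂ →ₗ[ℝ] Mat N :=
    { toFun := fun c => (c / N) • L 1
      map_add' := fun c d => by rw [add_div, add_smul]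
      map_smul' := fun c d => by rw [smul_div_assoc, smul_assoc, RingHom.id_apply] }
  let g : Mat N →ₗ[ℝ] ℂ := traceLinearMap (Fin N) ℝ ℂ
  have hfg : LinearMap.trace ℝ (Mat N) (f ∘ₗ g) = 0 := by
    rw [LinearMap.trace_comp_comm']
    have : g ∘ₗ f = 0 := by
      refine LinearMap.ext fun c => ?_
      change ((c / N) • L 1).trace = 0
      rw [trace_smul, ht, smul_zero]
    rw [this, map_zero]
  have h1 : LinearMap.trace ℝ (her0 N) (L.restrict hher) =
      LinearMap.trace ℝ (Mat N) ((her0 N).subtype ∘ₗ (L.restrict hher ∘ₗ toHer0 N)) := by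
    rw [LinearMap.trace_comp_comm', LinearMap.comp_assoc]
    congr 1
    ext1 X
    simp [toHer0_coe]
  have h2 : (her0 N).subtype ∘ₗ (L.restrict hher ∘ₗ toHer0 N) =
      (1 / 2 : ℝ) • (L - f ∘ₗ g + Q) := by
    ext1 X
    change L (toHer0 N X : Mat N) = (1 / 2 : ℝ) • (L X - (X.trace / N) • L 1 + L ((tl X)ᴴ))
    rw [coe_toHer0, map_smul, map_add]
    congr 2
    rw [tl, map_sub, hc]
  rw [h1, h2, map_smul, map_add, map_sub, hfg, hQ, smul_eq_mul]
  ring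

theorem relax_eq_sum {r : ℕ} (V : Fin r → Mat N) : relax V = (1 / 2 : ℝ) • ∑ k,
    (sandwich ((V k)ᴴ * V k) 1 + sandwich 1 ((V k)ᴴ * V k)
      - (2 : ℝ) • sandwich (V k) (V k)ᴴ) := by
  ext1 X
  change (1 / 2 : ℝ) • ∑ k, ((V k)ᴴ * V k * X + X * ((V k)ᴴ * V k)
      - (2 : ℝ) • (V k * X * (V k)ᴴ)) = _
  simp [LinearMap.sum_apply, sandwich_apply]

theorem trace_tl_conjTranspose_mul_tl (V : Mat N) :
    (N : ℂ) * ((tl V)ᴴ * tl V).trace = N * (Vᴴ * V).trace - V.trace * Vᴴ.trace := by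
  rcases Nat.eq_zero_or_pos N with h | h
  · subst h; simp
  · have hN : (N : ℂ) ≠ 0 := Nat.cast_ne_zero.2 h.ne'
    have : ((tl V)ᴴ * tl V).trace = ((tl V)ᴴ * V).trace := by
      have h1 : (tl V)ᴴ * tl V = (tl V)ᴴ * V - (tl V)ᴴ * ((V.trace / (N : ℂ)) • (1 : Mat N)) := by
        rw [← mul_sub, tl]
      rw [h1, trace_sub, mul_smul_comm, mul_one, trace_smul, trace_conjTranspose, trace_tl]
      simp
    rw [this, tl, conjTranspose_sub, conjTranspose_smul, conjTranspose_one, sub_mul, smul_mul_assoc,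
      one_mul, trace_sub, trace_smul, trace_conjTranspose, star_div₀, star_natCast, smul_eq_mul]
    field_simp

/-- On all matrices the real trace is `2 ∑ₖ (N tr(Vₖ† Vₖ) - |tr Vₖ|²)`, and half of it remains on
`her₀(N)`. The Cauchy–Schwarz defect in brackets is `N ‖tl Vₖ‖²`, so positivity becomes visible. -/
theorem trace_relax0 {r : ℕ} (V : Fin r → Mat N) : LinearMap.trace ℝ (her0 N) (relax0 V) =
    ∑ k, N * ((tl (V k))ᴴ * tl (V k)).trace.re := by
  rw [relax0, trace_restrict_her0]
  · rw [relax_eq_sum, map_smul, map_sum, smul_eq_mul, Finset.mul_sum, Finset.sum_div]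
    refine Finset.sum_congr rfl fun k _ => ?_
    have h := congrArg Complex.re (trace_tl_conjTranspose_mul_tl (V k))
    rw [← ofReal_natCast, re_ofReal_mul, sub_re, re_ofReal_mul] at h
    rw [h, map_sub, map_add, map_smul, trace_sandwich, trace_sandwich, trace_sandwich, trace_one,
      Fintype.card_fin, ← ofReal_natCast, re_ofReal_mul, re_mul_ofReal, smul_eq_mul]
    ring
  · intro X
    simp [relax_eq_sum, LinearMap.sum_apply, sandwich_apply, Finset.smul_sum, smul_sub, smul_add,
      smul_comm _ I]
  · intro X
    change ((1 / 2 : ℝ) • ∑ k, ((V k)ᴴ * V k * X + X * ((V k)ᴴ * V k)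
      - (2 : ℝ) • (V k * X * (V k)ᴴ))).trace = 0
    rw [trace_smul, trace_sum, Finset.sum_eq_zero, smul_zero]
    intro k _
    rw [trace_sub, trace_add, trace_smul, trace_mul_comm X, trace_mul_comm (V k * X),
      ← Matrix.mul_assoc, two_smul, sub_self]

theorem trace_conjTranspose_mul_self_re_nonneg (X : Mat N) : 0 ≤ (Xᴴ * X).trace.re := by
  open scoped ComplexOrder in
  exact (Complex.le_def.1 (posSemidef_conjTranspose_mul_self X).trace_nonneg).1

theorem eq_zero_of_trace_conjTranspose_mul_self_re {X : Mat N} (h : (Xᴴ * X).trace.re = 0) :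
    X = 0 := by
  open scoped ComplexOrder in
  have h1 := (Complex.le_def.1 (posSemidef_conjTranspose_mul_self X).trace_nonneg).2
  open scoped ComplexOrder in
  exact trace_conjTranspose_mul_self_eq_zero_iff.1 (Complex.ext h h1.symm)

theorem trace_relax0_pos {r : ℕ} {V : Fin r → Mat N} {k : Fin r} (h : tl (V k) ≠ 0) :
    0 < LinearMap.trace ℝ (her0 N) (relax0 V) := by
  have hN : 0 < N := Nat.pos_of_ne_zero fun hN => h (by subst hN; exact Subsingleton.elim _ _)
  have hN' : (0 : ℝ) < N := Nat.cast_pos.2 hN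
  rw [trace_relax0]
  refine Finset.sum_pos' (fun k _ => mul_nonneg hN'.le (trace_conjTranspose_mul_self_re_nonneg _))
    ⟨k, Finset.mem_univ _, mul_pos hN' ?_⟩
  exact (trace_conjTranspose_mul_self_re_nonneg _).lt_of_ne' fun h0 =>
    h (eq_zero_of_trace_conjTranspose_mul_self_re h0)

theorem relax0_ne_zero_of_tl_ne_zero {r : ℕ} {V : Fin r → Mat N} {k : Fin r} (h : tl (V k) ≠ 0) :
    relax0 V ≠ 0 := fun h0 => by
  have := trace_relax0_pos h
  rw [h0, map_zero] at this
  exact lt_irrefl _ this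

/-- If every Lindblad operator is scalar, relaxation vanishes identically; otherwise a nonscalar one
makes the trace positive. -/
theorem trace_relax0_pos_of_ne_zero {r : ℕ} {V : Fin r → Mat N} (h : relax0 V ≠ 0) :
    0 < LinearMap.trace ℝ (her0 N) (relax0 V) := by
  by_cases hV : ∃ k, tl (V k) ≠ 0
  · obtain ⟨k, hk⟩ := hV
    exact trace_relax0_pos hk
  · push Not at hV
    refine absurd (LinearMap.ext fun X => Subtype.ext ?_) h
    change (1 / 2 : ℝ) • ∑ k, ((V k)ᴴ * V k * (X : Mat N) + X * ((V k)ᴴ * V k)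
      - (2 : ℝ) • (V k * X * (V k)ᴴ)) = 0
    rw [Finset.sum_eq_zero, smul_zero]
    intro k _
    have hk : V k = ((V k).trace / (N : ℂ)) • 1 := sub_eq_zero.1 (hV k)
    rw [hk]
    simp only [conjTranspose_smul, conjTranspose_one, smul_mul_assoc, mul_smul_comm, one_mul,
      mul_one]
    rw [two_smul, smul_comm, sub_self]

theorem trace_iad0 {H : Mat N} (hH : H.IsHermitian) :
    LinearMap.trace ℝ (her0 N) (iad0 H hH) = 0 := by
  rw [iad0, trace_restrict_her0]
  · have : iad H = sandwich (I • H) 1 - sandwich 1 (I • H) := by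
      ext1 X
      change I • (H * X - X * H) = _
      simp [sandwich_apply, smul_sub]
    rw [this, map_sub, trace_sandwich, trace_sandwich, mul_comm (trace 1), sub_self, zero_div]
  · intro X
    change I • (H * (I • X) - (I • X) * H) = I • I • (H * X - X * H)
    rw [mul_smul_comm, smul_mul_assoc, ← smul_sub]
  · intro X
    change (I • (H * X - X * H)).trace = 0
    rw [trace_smul, trace_sub, trace_mul_comm, sub_self, smul_zero]

theorem isOpen_relax0_ne_zero (r : ℕ) : IsOpen {V : Fin r → Mat N | relax0 V ≠ 0} := by
  have : {V : Fin r → Mat N | relax0 V ≠ 0} =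
      ⋃ X : her0 N, {V : Fin r → Mat N | relax V (X : Mat N) ≠ 0} := by
    ext V
    simp only [mem_ofPred_eq, mem_iUnion]
    constructor
    · intro h
      by_contra hall
      push Not at hall
      exact h (LinearMap.ext fun X => Subtype.ext (hall X))
    · rintro ⟨X, hX⟩ h
      exact hX (congrArg (fun P : Module.End ℝ (her0 N) => (P X : Mat N)) h)
  rw [this]
  refine isOpen_iUnion fun X => isOpen_ne_fun ?_ continuous_const
  change Continuous fun V : Fin r → Mat N => (1 / 2 : ℝ) •
    ∑ k, ((V k)ᴴ * V k * (X : Mat N) + X * ((V k)ᴴ * V k) - (2 : ℝ) • (V k * X * (V k)ᴴ))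
  fun_prop

/-- A nonzero off-diagonal entry already makes a Lindblad operator nonscalar. Reading off that entry
is an open map, so the preimage of the dense set of nonzero numbers is dense. -/
theorem dense_relax0_ne_zero {r : ℕ} (hr : 0 < r) (hN : 2 ≤ N) :
    Dense {V : Fin r → Mat N | relax0 V ≠ 0} := by
  let k : Fin r := ⟨0, hr⟩
  let i : Fin N := ⟨0, by omega⟩
  let j : Fin N := ⟨1, by omega⟩
  have hij : i ≠ j := by simp [i, j]
  have hopen : IsOpenMap fun V : Fin r → Mat N => V k i j :=
    (isOpenMap_eval j).comp ((isOpenMap_eval i).comp (isOpenMap_eval k))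
  have hd : Dense ((fun V : Fin r → Mat N => V k i j) ⁻¹' {0}ᶜ) :=
    (dense_compl_singleton (0 : ℂ)).preimage hopen
  refine hd.mono fun V (hV : V k i j ≠ 0) =>
    relax0_ne_zero_of_tl_ne_zero (k := k) fun h => hV ?_
  have := congrFun (congrFun h i) j
  simpa [tl, hij] using this

end Trace

end OpenQ

end

/-! ### Trajectories, propagators and reachable maps -/

noncomputable section

open Set Matrix Complex

namespace OpenQ

/-- The sup norm on matrices, with the topology of `Matrix`. -/
abbrev matNormedAddCommGroup (N : ℕ) : NormedAddCommGroup (Mat N) :=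
  let _ : NormedAddCommGroup (Mat N) := Matrix.normedAddCommGroup
  { (inferInstance : AddCommGroup (Mat N)) with
    norm := fun X => ‖X‖
    toMetricSpace := (Matrix.normedAddCommGroup (m := Fin N) (n := Fin N)
      (α := ℂ)).toMetricSpace.replaceTopology rfl
    dist_eq := fun X Y => dist_eq_norm_neg_add X Y }

attribute [local instance] matNormedAddCommGroup

/-- Matrices with the sup norm as a real normed space. -/
abbrev matNormedSpace (N : ℕ) : NormedSpace ℝ (Mat N) :=
  { (inferInstance : Module ℝ (Mat N)) with
    norm_smul_le := (Matrix.normedSpace (m := Fin N) (n := Fin N) (α := ℂ) (R := ℝ)).norm_smul_le }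

attribute [local instance] matNormedSpace

section Propagators

theorem continuous_toContinuousLinearMap_affine {E : Type*} [NormedAddCommGroup E]
    [NormedSpace ℝ E] [FiniteDimensional ℝ E] {m : ℕ} (A : Module.End ℝ E)
    (B : Fin m → Module.End ℝ E) :
    Continuous fun u : Fin m → ℝ => LinearMap.toContinuousLinearMap (-(A + ∑ j, u j • B j)) := by
  simp only [neg_add, ← sub_eq_add_neg, map_sub, map_sum, map_smul]
  fun_prop

variable {N m r : ℕ}

theorem hasDerivAt_mat_iff {X : ℝ → Mat N} {X' : Mat N} {t : ℝ} :
    HasDerivAt X X' t ↔ ∀ i j, HasDerivAt (fun s => X s i j) (X' i j) t :=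
  (hasDerivAt_pi (φ := X) (φ' := X')).trans
    (forall_congr' fun i => hasDerivAt_pi (φ := fun s => X s i) (φ' := X' i))

theorem continuousOn_mat_iff {X : ℝ → Mat N} {s : Set ℝ} :
    ContinuousOn X s ↔ ∀ i j, ContinuousOn (fun t => X t i j) s :=
  (continuousOn_pi (f := X)).trans (forall_congr' fun i => continuousOn_pi (f := fun t => X t i))

theorem hasDerivAt_mat_mul {X Y : ℝ → Mat N} {X' Y' : Mat N} {t : ℝ} (hX : HasDerivAt X X' t)
    (hY : HasDerivAt Y Y' t) :
    HasDerivAt (fun s => X s * Y s) (X' * Y t + X t * Y') t := by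
  rw [hasDerivAt_mat_iff] at *
  intro i j
  simp only [mul_apply, Matrix.add_apply, ← Finset.sum_add_distrib]
  exact HasDerivAt.fun_sum fun k _ => (hX i k).mul (hY k j)

theorem hasDerivAt_mat_conjTranspose {X : ℝ → Mat N} {X' : Mat N} {t : ℝ}
    (hX : HasDerivAt X X' t) : HasDerivAt (fun s => (X s)ᴴ) X'ᴴ t := by
  rw [hasDerivAt_mat_iff] at *
  exact fun i j => (hX j i).star

/-- There are finitely many entries, so their exceptional times can be collected into one finite
set. -/
theorem solvesOn_iff {T : ℝ} {X W : ℝ → Mat N} : SolvesOn T X W ↔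
    ContinuousOn X (Icc 0 T) ∧ ∃ B : Finset ℝ, ∀ t ∈ Ioo 0 T, t ∉ B → HasDerivAt X (W t) t := by
  classical
  constructor
  · intro h
    choose hc B hB using h
    refine ⟨continuousOn_mat_iff.2 hc,
      Finset.univ.biUnion fun i => Finset.univ.biUnion fun j => B i j, fun t ht htB => ?_⟩
    refine hasDerivAt_mat_iff.2 fun i j => hB i j t ht fun hmem => htB ?_
    simp only [Finset.mem_biUnion, Finset.mem_univ, true_and]
    exact ⟨i, j, hmem⟩
  · rintro ⟨hc, B, hB⟩ i j
    exact ⟨continuousOn_mat_iff.1 hc i j, B, fun t ht htB => hasDerivAt_mat_iff.1 (hB t ht htB) i j⟩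

theorem iad_add (H K : Mat N) : iad (H + K) = iad H + iad K := by
  ext1 X
  change I • ((H + K) * X - X * (H + K)) = I • (H * X - X * H) + I • (K * X - X * K)
  rw [← smul_add]; congr 1; noncomm_ring

theorem iad_smul (c : ℝ) (H : Mat N) : iad (c • H) = c • iad H := by
  ext1 X
  change I • ((c • H) * X - X * (c • H)) = c • I • (H * X - X * H)
  rw [smul_mul_assoc, mul_smul_comm, ← smul_sub, smul_comm]

theorem iad_sum {ι : Type*} (s : Finset ι) (f : ι → Mat N) :
    iad (∑ j ∈ s, f j) = ∑ j ∈ s, iad (f j) := by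
  classical
  induction s using Finset.induction_on with
  | empty =>
    ext1 X
    change I • ((∑ j ∈ ∅, f j) * X - X * (∑ j ∈ ∅, f j)) = _
    simp
  | insert a s ha ih => rw [Finset.sum_insert ha, Finset.sum_insert ha, iad_add, ih]

theorem coe_iad0 {H : Mat N} (hH : H.IsHermitian) (X : her0 N) :
    (iad0 H hH X : Mat N) = I • (H * (X : Mat N) - (X : Mat N) * H) := rfl

namespace System

variable (S : System N m r)

theorem gen_eq (u : Fin m → ℝ) :
    S.gen u = (iad S.Hd + relax S.V) + ∑ j, u j • iad (S.H j) := by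
  rw [gen, Hu, iad_add, iad_sum]
  simp only [iad_smul]
  abel

theorem gen0_eq (u : Fin m → ℝ) :
    S.gen0 u = (iad0 S.Hd S.Hd_herm + relax0 S.V) + ∑ j, u j • iad0 (S.H j) (S.H_herm j) := by
  refine LinearMap.ext fun X => Subtype.ext ?_
  have h := congrArg (fun L : Mat N →ₗ[ℝ] Mat N => L (X : Mat N)) (S.gen_eq u)
  refine h.trans ?_
  simp only [LinearMap.add_apply, LinearMap.sum_apply, LinearMap.smul_apply, Submodule.coe_add,
    Submodule.coe_sum, Submodule.coe_smul]
  rfl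

/-- The generator of the master equation as a continuous linear map. -/
def genL (u : Fin m → ℝ) : Mat N →L[ℝ] Mat N := LinearMap.toContinuousLinearMap (-S.gen u)

/-- The generator of the master equation on `her₀(N)` as a continuous linear map. -/
def gen0L (u : Fin m → ℝ) : her0 N →L[ℝ] her0 N := LinearMap.toContinuousLinearMap (-S.gen0 u)

theorem continuous_genL : Continuous S.genL := by
  have : S.genL = fun u => LinearMap.toContinuousLinearMap
      (-((iad S.Hd + relax S.V) + ∑ j, u j • iad (S.H j))) := by
    funext u
    rw [genL, gen_eq]
  rw [this]
  exact continuous_toContinuousLinearMap_affine _ _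

theorem continuous_gen0L : Continuous S.gen0L := by
  have : S.gen0L = fun u => LinearMap.toContinuousLinearMap
      (-((iad0 S.Hd S.Hd_herm + relax0 S.V) + ∑ j, u j • iad0 (S.H j) (S.H_herm j))) := by
    funext u
    rw [gen0L, gen0_eq]
  rw [this]
  exact continuous_toContinuousLinearMap_affine _ _

theorem isTrajectory_iff {T : ℝ} {u : ℝ → Fin m → ℝ} {ρ₀ : Mat N} {ρ : ℝ → Mat N} :
    S.IsTrajectory T u ρ₀ ρ ↔ ρ 0 = ρ₀ ∧ LinSol (fun t => S.genL (u t)) 0 T ρ :=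
  and_congr_right' solvesOn_iff

theorem piecewiseContOn_genL {T : ℝ} {u : ℝ → Fin m → ℝ} (hu : PiecewiseCont T u) :
    PiecewiseContOn 0 T fun t => S.genL (u t) :=
  PiecewiseContOn.comp (a := 0) (b := T) (f := u) hu S.continuous_genL

theorem exists_trajectory {T : ℝ} (hT : 0 ≤ T) {u : ℝ → Fin m → ℝ} (hu : PiecewiseCont T u)
    (ρ₀ : Mat N) : ∃ ρ, S.IsTrajectory T u ρ₀ ρ := by
  have : CompleteSpace (Mat N) := FiniteDimensional.complete ℝ _
  obtain ⟨ρ, h0, hρ⟩ := (S.piecewiseContOn_genL hu).exists_linSol hT ρ₀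
  exact ⟨ρ, S.isTrajectory_iff.2 ⟨h0, hρ⟩⟩

variable {S}

theorem IsTrajectory.eq {T : ℝ} {u : ℝ → Fin m → ℝ} (hu : PiecewiseCont T u)
    {ρ₀ : Mat N} {ρ σ : ℝ → Mat N} (hρ : S.IsTrajectory T u ρ₀ ρ) (hσ : S.IsTrajectory T u ρ₀ σ)
    {t : ℝ} (ht : t ∈ Icc 0 T) : ρ t = σ t := by
  rw [isTrajectory_iff] at hρ hσ
  exact LinSol.eq_of_eq (S.piecewiseContOn_genL hu) hρ.2 hσ.2 (hρ.1.trans hσ.1.symm) ht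

theorem IsTrajectory.sub {T : ℝ} {u : ℝ → Fin m → ℝ}
    {ρ₀ σ₀ : Mat N} {ρ σ : ℝ → Mat N} (hρ : S.IsTrajectory T u ρ₀ ρ)
    (hσ : S.IsTrajectory T u σ₀ σ) :
    S.IsTrajectory T u (ρ₀ - σ₀) (fun t => ρ t - σ t) := by
  classical
  rw [isTrajectory_iff] at *
  obtain ⟨h0, hc, B, hB⟩ := hρ
  obtain ⟨h0', hc', B', hB'⟩ := hσ
  refine ⟨by rw [h0, h0'], hc.sub hc', B ∪ B', fun t ht htB => ?_⟩
  simp only [Finset.mem_union, not_or] at htB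
  rw [map_sub]
  exact (hB t ht htB.1).sub (hB' t ht htB.2)

theorem IsTrajectory.mono {s T : ℝ} {u v : ℝ → Fin m → ℝ} {ρ₀ : Mat N} {ρ : ℝ → Mat N}
    (hρ : S.IsTrajectory T u ρ₀ ρ) (hs : s ≤ T) (huv : EqOn u v (Ioo 0 s)) :
    S.IsTrajectory s v ρ₀ ρ := by
  rw [isTrajectory_iff] at *
  exact ⟨hρ.1, (hρ.2.mono le_rfl hs).congr fun t ht => by simp only [huv ht]⟩

theorem IsTrajectory.shift {s T : ℝ} (hs : 0 ≤ s) {u v : ℝ → Fin m → ℝ} {ρ₀ : Mat N}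
    {ρ : ℝ → Mat N} (hρ : S.IsTrajectory (s + T) u ρ₀ ρ)
    (huv : ∀ t ∈ Ioo 0 T, u (s + t) = v t) :
    S.IsTrajectory T v (ρ s) (fun t => ρ (s + t)) := by
  classical
  rw [isTrajectory_iff] at *
  obtain ⟨-, hc, B, hB⟩ := hρ
  refine ⟨by simp, hc.comp (by fun_prop) (fun t ht => ⟨by linarith [ht.1], by linarith [ht.2]⟩),
    B.image (fun b => b - s), fun t ht htB => ?_⟩
  have h := hB (s + t) ⟨by linarith [ht.1], by linarith [ht.2]⟩
    (fun h => htB (Finset.mem_image.2 ⟨_, h, by ring⟩))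
  simp only [huv t ht] at h
  exact h.comp_const_add s t

theorem isPropagator_iff {T : ℝ} {u : ℝ → Fin m → ℝ} {F : ℝ → Module.End ℝ (her0 N)} :
    S.IsPropagator T u F ↔
      F 0 = 1 ∧ ∀ X : her0 N, S.IsTrajectory T u X (fun t => (F t X : Mat N)) := by
  constructor
  · rintro ⟨h0, h⟩
    exact ⟨h0, fun X => ⟨by simp [h0], h X⟩⟩
  · rintro ⟨h0, h⟩
    exact ⟨h0, fun X => (h X).2⟩

theorem IsPropagator.trajectory {T : ℝ} {u : ℝ → Fin m → ℝ} {F : ℝ → Module.End ℝ (her0 N)}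
    (hF : S.IsPropagator T u F) (X : her0 N) :
    S.IsTrajectory T u X (fun t => (F t X : Mat N)) :=
  (isPropagator_iff.1 hF).2 X

theorem IsPropagator.eq {T : ℝ} {u : ℝ → Fin m → ℝ} (hu : PiecewiseCont T u)
    {F G : ℝ → Module.End ℝ (her0 N)} (hF : S.IsPropagator T u F) (hG : S.IsPropagator T u G)
    {t : ℝ} (ht : t ∈ Icc 0 T) : F t = G t :=
  LinearMap.ext fun X => Subtype.ext ((hF.trajectory X).eq hu (hG.trajectory X) ht)

theorem IsPropagator.mono {s T : ℝ} {u v : ℝ → Fin m → ℝ} {F : ℝ → Module.End ℝ (her0 N)}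
    (hF : S.IsPropagator T u F) (hs : s ≤ T) (huv : EqOn u v (Ioo 0 s)) :
    S.IsPropagator s v F :=
  isPropagator_iff.2 ⟨hF.1, fun X => (hF.trajectory X).mono hs huv⟩

theorem isPropagator_of_clm {T : ℝ} {u : ℝ → Fin m → ℝ} {F : ℝ → her0 N →L[ℝ] her0 N}
    (h0 : F 0 = 1) (hc : ContinuousOn F (Icc 0 T)) {B : Finset ℝ}
    (hB : ∀ t ∈ Ioo 0 T, t ∉ B → HasDerivAt F (S.gen0L (u t) * F t) t) :
    S.IsPropagator T u fun t => (F t : Module.End ℝ (her0 N)) := by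
  refine isPropagator_iff.2 ⟨by rw [h0]; rfl, fun X => S.isTrajectory_iff.2 ?_⟩
  refine ⟨by simp [h0], ?_, B, fun t ht htB => ?_⟩
  · exact continuous_subtype_val.comp_continuousOn (hc.clm_apply continuousOn_const)
  · exact (her0 N).subtypeL.hasFDerivAt.comp_hasDerivAt t
      ((hB t ht htB).clm_apply (hasDerivAt_const t X)) |>.congr_deriv (by simp; rfl)

/-- Hamiltonian terms have trace zero, so the trace of the generator, and with it the determinant,
is independent of the control. -/
theorem exists_propagator {T : ℝ} (hT : 0 ≤ T) {u : ℝ → Fin m → ℝ} (hu : PiecewiseCont T u) :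
    ∃ F : ℝ → Module.End ℝ (her0 N), S.IsPropagator T u F ∧ IsUnit (F T) ∧
      LinearMap.det (F T) = Real.exp (T * -LinearMap.trace ℝ (her0 N) (relax0 S.V)) := by
  have hpc : PiecewiseContOn 0 T fun t => S.gen0L (u t) :=
    PiecewiseContOn.comp (a := 0) (b := T) (f := u) hu S.continuous_gen0L
  obtain ⟨F, h0, hc, ⟨B, hB⟩, hinj, -⟩ := hpc.exists_fundamental hT
  refine ⟨fun t => F t, isPropagator_of_clm h0 hc hB,
    (LinearMap.isUnit_iff_ker_eq_bot _).2 (LinearMap.ker_eq_bot.2 (hinj T ⟨hT, le_rfl⟩)), ?_⟩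
  refine det_fundamental hT h0 hc hB fun t => ?_
  refine (map_neg (LinearMap.trace ℝ (her0 N)) (S.gen0 (u t))).trans ?_
  rw [gen0, map_add, trace_iad0, zero_add]

theorem flow_mem_reach {s : ℝ} (u : Fin m → ℝ) : flow s (-S.gen0 u) ∈ S.reach s := by
  refine ⟨fun _ => u, fun t => flow t (-S.gen0 u), ?_, ?_, rfl⟩
  · exact Continuous.piecewiseContOn (a := 0) (b := s) (f := fun _ : ℝ => u) continuous_const
  · have hd := hasDerivAt_exp_clm (S.gen0L u)
    exact isPropagator_of_clm (B := ∅) (by simp)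
      (fun t _ => (hd t).continuousAt.continuousWithinAt) (fun t _ _ => hd t)

theorem one_mem_reach_zero : (1 : Module.End ℝ (her0 N)) ∈ S.reach 0 := by
  have := flow_mem_reach (S := S) (s := 0) 0
  rwa [flow_zero] at this

/-- The propagator of the concatenated control agrees with `F` up to `s`; shifted by `s` it solves
the equation of `G` from the initial value `F s X`, and uniqueness identifies the two. -/
theorem mul_mem_reach {s t : ℝ} (hs : 0 ≤ s) (ht : 0 ≤ t) {P Q : Module.End ℝ (her0 N)}
    (hP : P ∈ S.reach s) (hQ : Q ∈ S.reach t) : Q * P ∈ S.reach (s + t) := by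
  obtain ⟨u, F, hu, hF, rfl⟩ := hP
  obtain ⟨v, G, hv, hG, rfl⟩ := hQ
  have hw : PiecewiseCont (s + t) (fun τ => if τ ≤ s then u τ else v (τ - s)) :=
    PiecewiseContOn.concat (f := u) (g := v) hu hv
  obtain ⟨K, hK, -⟩ := S.exists_propagator (add_nonneg hs ht) hw
  refine ⟨_, K, hw, hK, LinearMap.ext fun X => Subtype.ext ?_⟩
  have h1 : K s = F s := (hK.mono (le_add_of_nonneg_right ht) fun τ hτ =>
    if_pos hτ.2.le : S.IsPropagator s u K).eq hu hF ⟨hs, le_rfl⟩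
  have h2 := (hK.trajectory X).shift (v := v) hs (fun τ hτ => by
    simp only [if_neg (not_le.2 (lt_add_of_pos_right s hτ.1)), add_sub_cancel_left])
  simp only [h1] at h2
  exact h2.eq hv (hG.trajectory (F s X)) ⟨ht, le_rfl⟩

theorem isUnit_and_det_of_mem_reach {T : ℝ} (hT : 0 ≤ T) {P : Module.End ℝ (her0 N)}
    (hP : P ∈ S.reach T) : IsUnit P ∧
      LinearMap.det P = Real.exp (T * -LinearMap.trace ℝ (her0 N) (relax0 S.V)) := by
  obtain ⟨u, F, hu, hF, rfl⟩ := hP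
  obtain ⟨G, hG, h⟩ := S.exists_propagator hT hu
  rwa [hF.eq hu hG ⟨hT, le_rfl⟩]

theorem mem_heis_iff {T : ℝ} {Φ : Module.End ℝ (her0 N)} :
    Φ ∈ S.heis T ↔ ∃ P ∈ S.reach T, Φ = adj N P := by
  refine exists_congr fun P => and_congr_right fun _ => ⟨fun h => ?_, ?_⟩
  · exact eq_adj fun X Y => ofReal_injective (by rw [ofReal_hs, ofReal_hs, h])
  · rintro rfl X Y
    rw [← ofReal_hs, hs_adj, ofReal_hs]

theorem adj_mem_heis {T : ℝ} {P : Module.End ℝ (her0 N)} (hP : P ∈ S.reach T) :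
    adj N P ∈ S.heis T := mem_heis_iff.2 ⟨P, hP, rfl⟩

/-- Adjoints reverse the order, so the map applied last to the observable belongs to the control
used first. Prepending a control therefore moves the observability space at `t` into the one at `s +
t`. -/
theorem mul_mem_heis {s t : ℝ} (hs : 0 ≤ s) (ht : 0 ≤ t) {Φ Ψ : Module.End ℝ (her0 N)}
    (hΦ : Φ ∈ S.heis s) (hΨ : Ψ ∈ S.heis t) : Φ * Ψ ∈ S.heis (s + t) := by
  obtain ⟨P, hP, rfl⟩ := mem_heis_iff.1 hΦ
  obtain ⟨Q, hQ, rfl⟩ := mem_heis_iff.1 hΨ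
  rw [← adj_mul]
  exact adj_mem_heis (mul_mem_reach hs ht hP hQ)

theorem flow_mem_heis {s : ℝ} (u : Fin m → ℝ) : flow s (adj N (-S.gen0 u)) ∈ S.heis s := by
  rw [← map_flow (adj N) adj_one adj_mul]
  exact adj_mem_heis (flow_mem_reach u)

theorem isUnit_of_mem_heis {T : ℝ} (hT : 0 ≤ T) {Φ : Module.End ℝ (her0 N)}
    (hΦ : Φ ∈ S.heis T) : IsUnit Φ := by
  obtain ⟨P, hP, rfl⟩ := mem_heis_iff.1 hΦ
  exact isUnit_adj (isUnit_and_det_of_mem_reach hT hP).1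

theorem heisUpTo_mono {s t : ℝ} (h : s ≤ t) : S.heisUpTo s ⊆ S.heisUpTo t :=
  biUnion_subset_biUnion_left (Icc_subset_Icc_right h)

theorem mem_heisUpTo {T : ℝ} {Φ : Module.End ℝ (her0 N)} :
    Φ ∈ S.heisUpTo T ↔ ∃ t ∈ Icc 0 T, Φ ∈ S.heis t := by
  simp only [heisUpTo, mem_iUnion, exists_prop]

/-- With nonzero trace of relaxation the determinant determines the time, so no map reached at time
`t` was reached by time `s`. -/
theorem heisUpTo_ssubset (hne : relax0 S.V ≠ 0) {s t : ℝ} (hs : 0 ≤ s) (hst : s < t) :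
    S.heisUpTo s ⊂ S.heisUpTo t := by
  refine (ssubset_iff_of_subset (heisUpTo_mono hst.le)).2
    ⟨_, mem_heisUpTo.2 ⟨t, ⟨hs.trans hst.le, le_rfl⟩, adj_mem_heis (flow_mem_reach 0)⟩, fun h => ?_⟩
  obtain ⟨τ, hτ, h⟩ := mem_heisUpTo.1 h
  obtain ⟨P, hP, hadj⟩ := mem_heis_iff.1 h
  have h1 := (isUnit_and_det_of_mem_reach hτ.1 hP).2
  rw [← adj_injective hadj, (isUnit_and_det_of_mem_reach (hs.trans hst.le) (flow_mem_reach 0)).2]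
    at h1
  have h2 := mul_right_cancel₀ (neg_ne_zero.2 (trace_relax0_pos_of_ne_zero hne).ne')
    (Real.exp_injective h1)
  linarith [hτ.2]

end System

end Propagators

end OpenQ

end

noncomputable section

open Set Matrix Complex

namespace OpenQ

attribute [local instance] matNormedAddCommGroup matNormedSpace

namespace System

variable {N m r : ℕ} {S : System N m r}

/-! ### Indistinguishable states -/

section Indistinguishable

/-- Indistinguishability quantifies over controls on all of `[0, T]`, while a Heisenberg map at an
earlier time provides a control only up to then. -/
theorem piecewiseCont_extend {s T : ℝ} {u : ℝ → Fin m → ℝ} (hu : PiecewiseCont s u) :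
    PiecewiseCont T (fun τ => if τ ≤ s then u τ else 0) := by
  have h0 : PiecewiseContOn 0 (T - s) (fun _ : ℝ => (0 : Fin m → ℝ)) :=
    Continuous.piecewiseContOn continuous_const
  have h := PiecewiseContOn.concat (f := u) hu h0
  rwa [add_sub_cancel] at h

theorem trace_tl_mul {C X : Mat N} (hX : X.trace = 0) : (tl C * X).trace = (C * X).trace := by
  rw [tl, sub_mul, smul_mul_assoc, one_mul, trace_sub, trace_smul, hX, smul_zero, sub_zero]

/-- The difference of two density operators is traceless Hermitian, so it evolves by the propagator
and does not see the scalar part of `C`; the adjoint moves the evolution to the observable. -/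
theorem trace_trajectory_sub {C : Mat N} (hC : C.IsHermitian) {T : ℝ} {u : ℝ → Fin m → ℝ}
    (hu : PiecewiseCont T u) {F : ℝ → Module.End ℝ (her0 N)} (hF : S.IsPropagator T u F)
    {ρA ρB : Mat N} (hδ : ρA - ρB ∈ her0 N) {ρ σ : ℝ → Mat N} (hρ : S.IsTrajectory T u ρA ρ)
    (hσ : S.IsTrajectory T u ρB σ) {t : ℝ} (ht : t ∈ Icc 0 T) :
    (Cᴴ * ρ t).trace - (Cᴴ * σ t).trace =
      ((adj N (F t) ⟨tl C, tl_mem_her0 hC⟩ : Mat N) * (ρA - ρB)).trace := by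
  have h := (hρ.sub hσ).eq hu (hF.trajectory ⟨ρA - ρB, hδ⟩) ht
  have h1 := ofReal_hs (adj N (F t) ⟨tl C, tl_mem_her0 hC⟩) ⟨ρA - ρB, hδ⟩
  rw [hs_adj, ofReal_hs] at h1
  rw [← trace_sub, ← mul_sub, hC.eq]
  refine Eq.trans ?_ h1
  change _ = (tl C * (F t ⟨ρA - ρB, hδ⟩ : Mat N)).trace
  rw [trace_tl_mul (F t ⟨ρA - ρB, hδ⟩).2.2, ← h]

open scoped ComplexOrder in
theorem indistinguishable_iff {C : Mat N} (hC : C.IsHermitian) {T : ℝ} (hT : 0 ≤ T)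
    {ρA ρB : Mat N} (hA : IsDensity ρA) (hB : IsDensity ρB) :
    S.Indistinguishable C T ρA ρB ↔ ∀ X ∈ S.obsUpTo hC T, ((ρA - ρB) * X).trace = 0 := by
  have hδ : ρA - ρB ∈ her0 N :=
    ⟨hA.1.isHermitian.sub hB.1.isHermitian, by rw [trace_sub, hA.2, hB.2, sub_self]⟩
  constructor
  · intro h X hX
    induction hX using Submodule.span_induction with
    | zero => simp
    | add X Y _ _ hX hY => rw [mul_add, trace_add, hX, hY, add_zero]
    | smul c X _ hX => rw [mul_smul_comm, trace_smul, hX, smul_zero]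
    | mem X hX =>
      obtain ⟨Φ, hΦ, rfl⟩ := hX
      obtain ⟨t, ht, hΦ⟩ := mem_heisUpTo.1 hΦ
      obtain ⟨P, ⟨u, F, hu, hF, rfl⟩, rfl⟩ := mem_heis_iff.1 hΦ
      have hv := piecewiseCont_extend (T := T) hu
      obtain ⟨G, hG, -⟩ := S.exists_propagator hT hv
      obtain ⟨ρ, hρ⟩ := S.exists_trajectory hT hv ρA
      obtain ⟨σ, hσ⟩ := S.exists_trajectory hT hv ρB
      have hGF : G t = F t := (hG.mono ht.2 fun τ hτ => if_pos hτ.2.le :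
        S.IsPropagator t u G).eq hu hF ⟨ht.1, le_rfl⟩
      have h1 := trace_trajectory_sub hC hv hG hδ hρ hσ ht
      rw [h _ hv ρ σ hρ hσ t ht, sub_self, hGF] at h1
      simp only [mul_smul_comm, trace_smul]
      rw [trace_mul_comm, ← h1, smul_zero]
  · intro h u hu ρ σ hρ hσ t ht
    obtain ⟨F, hF, -⟩ := S.exists_propagator hT hu
    rw [← sub_eq_zero, trace_trajectory_sub hC hu hF hδ hρ hσ ht]
    have hut : PiecewiseCont t u := PiecewiseContOn.mono (f := u) (a := 0) (b := T) hu le_rfl ht.2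
    have hmem : adj N (F t) ∈ S.heisUpTo T := mem_heisUpTo.2 ⟨t, ht, adj_mem_heis
      ⟨u, F, hut, hF.mono ht.2 fun _ _ => rfl, rfl⟩⟩
    have h1 := h _ (Submodule.subset_span ⟨_, hmem, rfl⟩)
    simp only [mul_smul_comm, trace_smul] at h1
    rw [trace_mul_comm]
    exact (smul_eq_zero.1 h1).resolve_left I_ne_zero

end Indistinguishable

/-! ### Observability spaces and their stabilizers -/

section ObservabilitySpace

/-- The span in `her₀(N)` of the propagated traceless observables for measurements at time `T`. -/
def herAt (S : System N m r) {C : Mat N} (hC : C.IsHermitian) (T : ℝ) : Submodule ℝ (her0 N) :=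
  Submodule.span ℝ ((fun Φ : Module.End ℝ (her0 N) => Φ ⟨tl C, tl_mem_her0 hC⟩) '' S.heis T)

variable {C : Mat N} {hC : C.IsHermitian}

theorem obsAt_eq_map (T : ℝ) : S.obsAt hC T = (S.herAt hC T).map (mulI N) := by
  rw [herAt, Submodule.map_span, image_image]
  rfl

theorem obsAt_le_su (T : ℝ) : S.obsAt hC T ≤ (su N).toSubmodule := by
  rw [obsAt_eq_map, ← range_mulI]
  exact LinearMap.map_le_range

theorem apply_mem_herAt {s T : ℝ} (hs : 0 ≤ s) (hT : 0 ≤ T) {Φ : Module.End ℝ (her0 N)}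
    (hΦ : Φ ∈ S.heis s) {x : her0 N} (hx : x ∈ S.herAt hC T) : Φ x ∈ S.herAt hC (s + T) := by
  induction hx using Submodule.span_induction with
  | zero => rw [map_zero]; exact Submodule.zero_mem _
  | add x y _ _ hx hy => rw [map_add]; exact Submodule.add_mem _ hx hy
  | smul c x _ hx => rw [map_smul]; exact Submodule.smul_mem _ _ hx
  | mem x hx =>
    obtain ⟨Ψ, hΨ, rfl⟩ := hx
    exact Submodule.subset_span ⟨Φ * Ψ, mul_mem_heis hs hT hΦ hΨ, rfl⟩

/-- The flow of the zero control embeds the earlier space into the later one; the spaces themselves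
need not be nested. -/
theorem finrank_herAt_mono {s t : ℝ} (hs : 0 ≤ s) (hst : s ≤ t) :
    Module.finrank ℝ (S.herAt hC s) ≤ Module.finrank ℝ (S.herAt hC t) := by
  have hle : (S.herAt hC s).map (flow (t - s) (adj N (-S.gen0 0))) ≤ S.herAt hC t := by
    refine Submodule.map_le_iff_le_comap.2 fun x hx => ?_
    have := apply_mem_herAt (sub_nonneg.2 hst) hs (flow_mem_heis 0) hx
    rwa [sub_add_cancel] at this
  have := Submodule.finrank_mono hle
  rwa [← (Submodule.equivMapOfInjective _ (flow_injective _ _) _).finrank_eq] at this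

theorem finrank_obsAt_mono {s t : ℝ} (hs : 0 ≤ s) (hst : s ≤ t) :
    Module.finrank ℝ (S.obsAt hC s) ≤ Module.finrank ℝ (S.obsAt hC t) := by
  rw [obsAt_eq_map, obsAt_eq_map,
    ← (Submodule.equivMapOfInjective _ mulI_injective _).finrank_eq,
    ← (Submodule.equivMapOfInjective _ mulI_injective _).finrank_eq]
  exact finrank_herAt_mono hs hst

theorem herAt_ne_bot (hC0 : tl C ≠ 0) (T : ℝ) : S.herAt hC T ≠ ⊥ := by
  intro h
  have hΦ : flow T (adj N (-S.gen0 0)) ∈ S.heis T := flow_mem_heis 0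
  have h1 : flow T (adj N (-S.gen0 0)) ⟨tl C, tl_mem_her0 hC⟩ ∈ S.herAt hC T :=
    Submodule.subset_span ⟨_, hΦ, rfl⟩
  rw [h, Submodule.mem_bot] at h1
  exact hC0 (congrArg Subtype.val (flow_injective _ _ (h1.trans (map_zero _).symm)))

theorem coe_iad0_eq_lie {H : Mat N} (hH : H.IsHermitian) (x : her0 N) :
    (iad0 H hH x : Mat N) = ⁅I • H, (x : Mat N)⁆ := by
  rw [coe_iad0, Ring.lie_def, smul_mul_assoc, mul_smul_comm, smul_sub]

theorem adj_neg_gen0_apply (u : Fin m → ℝ) (x : her0 N) : adj N (-S.gen0 u) x =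
    ∑ j, u j • iad0 (S.H j) (S.H_herm j) x - adj N (iad0 S.Hd S.Hd_herm + relax0 S.V) x := by
  have h2 : ∀ j, adj N (u j • iad0 (S.H j) (S.H_herm j)) x = -(u j • iad0 (S.H j) (S.H_herm j) x) :=
    fun j => by
      rw [map_smul, adj_iad0]
      exact smul_neg (u j) (iad0 (S.H j) (S.H_herm j) x)
  rw [adj_neg_apply, gen0_eq, map_add, map_sum, LinearMap.add_apply, LinearMap.sum_apply,
    Finset.sum_congr rfl fun j _ => h2 j, Finset.sum_neg_distrib]
  abel

/-- The elements of `su(N)` whose adjoint action leaves the given subspaces invariant. -/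
def stabilizer (𝒲 : Set (Submodule ℝ (her0 N))) : LieSubalgebra ℝ (Mat N) where
  carrier := {K | K ∈ su N ∧ ∀ W ∈ 𝒲, ∀ x ∈ W.map (her0 N).subtype, ⁅K, x⁆ ∈ W.map (her0 N).subtype}
  add_mem' hK hL := ⟨(su N).add_mem hK.1 hL.1, fun W hW x hx => by
    rw [add_lie]; exact Submodule.add_mem _ (hK.2 W hW x hx) (hL.2 W hW x hx)⟩
  zero_mem' := ⟨(su N).zero_mem, fun W hW x hx => by rw [zero_lie]; exact Submodule.zero_mem _⟩
  smul_mem' c K hK := ⟨(su N).smul_mem c hK.1, fun W hW x hx => by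
    rw [smul_lie]; exact Submodule.smul_mem _ _ (hK.2 W hW x hx)⟩
  lie_mem' hK hL := ⟨(su N).lie_mem hK.1 hL.1, fun W hW x hx => by
    rw [lie_lie]
    exact Submodule.sub_mem _ (hK.2 W hW _ (hL.2 W hW x hx)) (hL.2 W hW _ (hK.2 W hW x hx))⟩

theorem Hd_mem_her0 (S : System N m r) : S.Hd ∈ her0 N := ⟨S.Hd_herm, S.Hd_trace⟩

theorem H_mem_her0 (S : System N m r) (j : Fin m) : S.H j ∈ her0 N := ⟨S.H_herm j, S.H_trace j⟩

-- The generators for the control `Pi.single j 1` and for zero differ exactly by the term of `H j`.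
-- A scalar relaxation drops out of commutators, so the bracket with the zero-control generator is
-- the bracket with `i H_d`.
variable (S) (hC) in
theorem exists_stabilizer : ∃ T₀ > 0,
    (∀ j, I • S.H j ∈ stabilizer (S.herAt hC '' Ioo 0 T₀)) ∧
    ∀ γ : ℝ, relax0 S.V = γ • 1 → ∀ K ∈ stabilizer (S.herAt hC '' Ioo 0 T₀),
      ⁅I • S.Hd, K⁆ ∈ stabilizer (S.herAt hC '' Ioo 0 T₀) := by
  obtain ⟨T₀, hT₀, hsub, hcomm⟩ := exists_invariant_near_zero
    (fun u : Fin m → ℝ => adj N (-S.gen0 u)) (S.herAt hC)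
    (fun u s T hs hT x hx => apply_mem_herAt hs hT.le (flow_mem_heis u) hx)
  refine ⟨T₀, hT₀, fun j => ⟨I_smul_mem_su (S.H_mem_her0 j), ?_⟩, fun γ hγ K hK =>
    ⟨(su N).lie_mem (I_smul_mem_su S.Hd_mem_her0) hK.1, ?_⟩⟩
  · rintro _ ⟨T, hT, rfl⟩ _ ⟨x, hx, rfl⟩
    refine ⟨iad0 (S.H j) (S.H_herm j) x, ?_, coe_iad0_eq_lie (S.H_herm j) x⟩
    have h := hsub (Pi.single j 1) 0 T hT x hx
    simp only [adj_neg_gen0_apply] at h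
    rw [Finset.sum_eq_single j (fun k _ hk => by rw [Pi.single_eq_of_ne hk, zero_smul]) (by simp),
      Pi.single_eq_same, one_smul] at h
    simp only [Pi.zero_apply, zero_smul, Finset.sum_const_zero] at h
    rwa [zero_sub, sub_neg_eq_add, sub_add_cancel] at h
  · rintro _ ⟨T, hT, rfl⟩ _ ⟨x, hx, rfl⟩
    let B := iad0 (-I • K) (neg_I_smul_mem_her0 hK.1).1
    have hB : ∀ y : her0 N, (B y : Mat N) = ⁅K, (y : Mat N)⁆ := fun y => by
      rw [coe_iad0_eq_lie, smul_smul]; simp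
    have hA : ∀ y : her0 N, adj N (-S.gen0 0) y = iad0 S.Hd S.Hd_herm y - γ • y := fun y => by
      rw [adj_neg_gen0_apply, hγ, map_add, map_smul, adj_one, adj_iad0]
      simp only [Pi.zero_apply, zero_smul, Finset.sum_const_zero, zero_sub]
      change -(-(iad0 S.Hd S.Hd_herm y) + γ • y) = _
      abel
    have h := hcomm 0 B (fun T hT y hy => by
      obtain ⟨z, hz, hzy⟩ := hK.2 _ ⟨T, hT, rfl⟩ _ ⟨y, hy, rfl⟩
      have : B y = z := Subtype.ext ((hB y).trans hzy.symm)
      rwa [this]) T hT x hx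
    refine ⟨_, h, ?_⟩
    simp only [hA, map_sub, map_smul]
    rw [sub_sub_sub_cancel_right]
    change ((iad0 S.Hd S.Hd_herm (B x) - B (iad0 S.Hd S.Hd_herm x) : her0 N) : Mat N) = _
    rw [Submodule.coe_sub, coe_iad0_eq_lie, hB, hB, coe_iad0_eq_lie, ← lie_lie]
    rfl

/-- Irreducibility fills the space at times in `(0, T₀)`; monotonicity of the dimension from `min T
(T₀ / 2)` covers later times. -/
theorem herAt_eq_top_of_su_le (hC0 : tl C ≠ 0) {T₀ : ℝ} (hT₀ : 0 < T₀)
    (h : su N ≤ stabilizer (S.herAt hC '' Ioo 0 T₀)) {T : ℝ} (hT : 0 < T) : S.herAt hC T = ⊤ := by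
  have hsmall : ∀ t ∈ Ioo 0 T₀, S.herAt hC t = ⊤ := fun t ht =>
    her0_irreducible (herAt_ne_bot hC0 t) fun H hH x hx => by
      obtain ⟨z, hz, hzx⟩ := (h (I_smul_mem_su hH)).2 _ ⟨t, ht, rfl⟩ _ ⟨x, hx, rfl⟩
      have : iad0 H hH.1 x = z := Subtype.ext ((coe_iad0_eq_lie hH.1 x).trans hzx.symm)
      rwa [this]
  have hmin : min T (T₀ / 2) ∈ Ioo 0 T₀ :=
    ⟨lt_min hT (half_pos hT₀), (min_le_right _ _).trans_lt (half_lt_self hT₀)⟩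
  have h1 := finrank_herAt_mono (S := S) (hC := hC) hmin.1.le (min_le_left T (T₀ / 2))
  rw [hsmall _ hmin, finrank_top] at h1
  exact Submodule.eq_top_of_finrank_eq (le_antisymm (Submodule.finrank_le _) h1)

theorem obsAt_eq_su_of_su_le (hC0 : tl C ≠ 0) {T₀ : ℝ} (hT₀ : 0 < T₀)
    (h : su N ≤ stabilizer (S.herAt hC '' Ioo 0 T₀)) {T : ℝ} (hT : 0 < T) :
    S.obsAt hC T = (su N).toSubmodule := by
  rw [obsAt_eq_map, herAt_eq_top_of_su_le hC0 hT₀ h hT, map_mulI_top]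

theorem obsAt_eq_su_of_hControllable (hC0 : tl C ≠ 0) (hH : S.HControllable) {T : ℝ}
    (hT : 0 < T) : S.obsAt hC T = (su N).toSubmodule := by
  obtain ⟨T₀, hT₀, hmem, -⟩ := S.exists_stabilizer hC
  refine obsAt_eq_su_of_su_le hC0 hT₀ ?_ hT
  rw [← show S.kc = su N from hH]
  refine LieSubalgebra.lieSpan_le.2 ?_
  rintro _ ⟨j, rfl⟩
  exact hmem j

/-- The matrices commuting with `L`. -/
def commutant (L : Mat N) : LieSubalgebra ℝ (Mat N) where
  carrier := {K | ⁅K, L⁆ = 0}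
  add_mem' {K K'} hK hK' := by
    change ⁅K + K', L⁆ = 0
    rw [add_lie, show ⁅K, L⁆ = 0 from hK, show ⁅K', L⁆ = 0 from hK', add_zero]
  zero_mem' := zero_lie L
  smul_mem' c K hK := by
    change ⁅c • K, L⁆ = 0
    rw [smul_lie, show ⁅K, L⁆ = 0 from hK, smul_zero]
  lie_mem' {K K'} hK hK' := by
    change ⁅⁅K, K'⁆, L⁆ = 0
    rw [lie_lie, show ⁅K, L⁆ = 0 from hK, show ⁅K', L⁆ = 0 from hK', lie_zero, lie_zero, sub_zero]

theorem mem_commutant {K L : Mat N} : K ∈ commutant L ↔ ⁅K, L⁆ = 0 := Iff.rfl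

/-- For a fully controllable system, `su(N)` is the only subalgebra which contains the control
Hamiltonians and is normalized by the drift. -/
theorem su_le_of_normalized (hfull : S.FullyControllable) {X : Mat N} (hX : X ∈ su N) (hX0 : X ≠ 0)
    {𝔤 : LieSubalgebra ℝ (Mat N)} (hle : 𝔤 ≤ su N) (hH : ∀ j, I • S.H j ∈ 𝔤)
    (hd : ∀ K ∈ 𝔤, ⁅I • S.Hd, K⁆ ∈ 𝔤) : su N ≤ 𝔤 := by
  have hkd : S.kd = su N := hfull
  by_cases hbot : 𝔤.toSubmodule = ⊥
  -- If `𝔤 = 0`, every `H j` vanishes and `𝔨_d` is generated by `i H_d` alone, hence abelian. Then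
  -- `X` commutes with `su(N)` and is a traceless scalar, that is, zero.
  · exfalso
    have hH0 : ∀ j, I • S.H j = 0 := fun j => by
      have : I • S.H j ∈ 𝔤.toSubmodule := hH j
      rwa [hbot, Submodule.mem_bot] at this
    have hle' : ∀ L, ⁅I • S.Hd, L⁆ = 0 → S.kd ≤ commutant L := fun L hL => by
      refine LieSubalgebra.lieSpan_le.2 (insert_subset hL ?_)
      rintro _ ⟨j, rfl⟩
      simp only [hH0]
      exact zero_lie L
    have hcomm : ∀ K ∈ su N, ⁅K, X⁆ = 0 := fun K hK => by
      rw [← hkd] at hK hX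
      refine hle' X ?_ hK
      rw [← lie_skew, mem_commutant.1 (hle' (I • S.Hd) (lie_self _) hX), neg_zero]
    obtain ⟨c, hc⟩ := eq_smul_one_of_commute_su (X := X) fun K hK => sub_eq_zero.1 (hcomm K hK)
    exact hX0 (eq_zero_of_scalar_of_trace hc hX.2)
  -- The normalizer is a Lie algebra containing the generators of `𝔨_d`, so `𝔤` is a nonzero ideal
  -- of `su(N)`.
  · have hnorm : S.kd ≤ 𝔤.normalizer := by
      refine LieSubalgebra.lieSpan_le.2 (insert_subset ?_ ?_)
      · exact (LieSubalgebra.mem_normalizer_iff _ _).2 hd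
      · rintro _ ⟨j, rfl⟩
        exact (LieSubalgebra.mem_normalizer_iff _ _).2 fun K hK => 𝔤.lie_mem (hH j) hK
    have := su_le_of_ideal (W := 𝔤.toSubmodule) hle (fun K hK Y hY =>
      (LieSubalgebra.mem_normalizer_iff _ _).1 (hnorm (hkd ▸ hK)) Y hY) hbot
    exact fun Y hY => (this ▸ hY : Y ∈ 𝔤.toSubmodule)

theorem obsAt_eq_su_of_whControllable (hC0 : tl C ≠ 0) {γ : ℝ} (hH : S.WHControllable γ) {T : ℝ}
    (hT : 0 < T) : S.obsAt hC T = (su N).toSubmodule := by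
  obtain ⟨T₀, hT₀, hmem, hdrift⟩ := S.exists_stabilizer hC
  refine obsAt_eq_su_of_su_le hC0 hT₀ (su_le_of_normalized hH.1 (I_smul_mem_su (tl_mem_her0 hC))
    (smul_ne_zero I_ne_zero hC0) (fun K hK => hK.1) hmem (hdrift γ hH.2.2)) hT

/-- If the dynamic Lie algebra of the open system is `gl(her₀(N))`, then the Heisenberg-picture
maps for measurements up to any positive time span `gl(her₀(N))`. -/
theorem span_heisUpTo_eq_top (h : S.sOpen = ⊤) {T : ℝ} (hT : 0 < T) :
    Submodule.span ℝ (S.heisUpTo T) = ⊤ := by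
  obtain ⟨T₀, hT₀, hmul⟩ := exists_mul_mem_near_zero (fun u : Fin m → ℝ => adj N (-S.gen0 u))
    (fun T => Submodule.span ℝ (S.heisUpTo T))
    (fun s t hst => Submodule.span_mono (heisUpTo_mono hst)) (fun u s T hs hT X hX => by
      induction hX using Submodule.span_induction with
      | zero => rw [mul_zero]; exact Submodule.zero_mem _
      | add X Y _ _ hX hY => rw [mul_add]; exact Submodule.add_mem _ hX hY
      | smul c X _ hX => rw [mul_smul_comm]; exact Submodule.smul_mem _ _ hX
      | mem X hX =>
        obtain ⟨t, ht, hX⟩ := mem_heisUpTo.1 hX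
        exact Submodule.subset_span (mem_heisUpTo.2 ⟨s + t, ⟨add_nonneg hs ht.1,
          by linarith [ht.2]⟩, mul_mem_heis hs ht.1 (flow_mem_heis u) hX⟩))
  have hmin : 0 < min T T₀ := lt_min hT hT₀
  suffices hs : Submodule.span ℝ (S.heisUpTo (min T T₀)) = ⊤ from
    top_le_iff.1 (hs ▸ Submodule.span_mono (heisUpTo_mono (min_le_left _ _)))
  have h1 : (1 : Module.End ℝ (her0 N)) ∈ Submodule.span ℝ (S.heisUpTo (min T T₀)) := by
    refine Submodule.subset_span (mem_heisUpTo.2 ⟨0, ⟨le_rfl, hmin.le⟩, ?_⟩)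
    rw [← adj_one]
    exact adj_mem_heis one_mem_reach_zero
  have hgen : ∀ u, ∀ X ∈ Submodule.span ℝ (S.heisUpTo (min T T₀)),
      adj N (S.gen0 u) * X ∈ Submodule.span ℝ (S.heisUpTo (min T T₀)) := fun u X hX => by
    have h2 : adj N (S.gen0 u) * X = (-1 : ℝ) • (adj N (-S.gen0 u) * X) :=
      LinearMap.ext fun x => by
        rw [LinearMap.smul_apply, Module.End.mul_apply, Module.End.mul_apply, adj_neg_apply,
          neg_one_smul, neg_neg]
    rw [h2]
    exact Submodule.smul_mem _ _ (hmul _ hmin (min_le_right _ _) u X hX)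
  have hgen0 : S.gen0 0 = iad0 S.Hd S.Hd_herm + relax0 S.V := by
    rw [gen0_eq]
    simp
  refine eq_top_of_lieSpan_eq_top adj_mul adj_surjective h h1 ?_
  rintro _ (rfl | ⟨j, rfl⟩) X hX
  · rw [← hgen0]
    exact hgen 0 X hX
  -- Control terms occur in generators only together with the drift; they are isolated as
  -- differences of two generators.
  · have h2 : adj N (iad0 (S.H j) (S.H_herm j)) * X =
        adj N (S.gen0 (Pi.single j 1)) * X + (-1 : ℝ) • (adj N (S.gen0 0) * X) := by
      rw [hgen0, gen0_eq, Finset.sum_eq_single j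
        (fun k _ hk => by rw [Pi.single_eq_of_ne hk, zero_smul]) (by simp), Pi.single_eq_same,
        one_smul]
      refine LinearMap.ext fun x => ?_
      simp only [map_add, LinearMap.add_apply, LinearMap.smul_apply, Module.End.mul_apply]
      module
    rw [h2]
    exact Submodule.add_mem _ (hgen _ X hX) (Submodule.smul_mem _ _ (hgen 0 X hX))

theorem obsUpTo_eq_su (hC0 : tl C ≠ 0) {T : ℝ} (h : Submodule.span ℝ (S.heisUpTo T) = ⊤) :
    S.obsUpTo hC T = (su N).toSubmodule := by
  let c : her0 N := ⟨tl C, tl_mem_her0 hC⟩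
  have hc : c ≠ 0 := fun h => hC0 (congrArg Subtype.val h)
  have h1 : S.obsUpTo hC T =
      (Submodule.span ℝ (S.heisUpTo T)).map (mulI N ∘ₗ LinearMap.applyₗ c) := by
    rw [Submodule.map_span]
    rfl
  rw [h1, h, Submodule.map_comp, ← map_mulI_top]
  congr 1
  refine top_le_iff.1 fun x _ => ?_
  -- The rank-one map `y ↦ ⟨c, y⟩ / ⟨c, c⟩ • x` sends `c` to `x`.
  refine ⟨((hs N c c)⁻¹ • hs N c).smulRight x, trivial, ?_⟩
  have hcc : hs N c c ≠ 0 := fun h => hc (hs_self_eq_zero h)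
  simp [hcc]

/-- Without relaxation all generators are skew for the Hilbert–Schmidt product, hence so is the Lie
algebra they generate, which then misses the identity of the nonzero space `her₀(N)`. -/
theorem relax0_ne_zero_of_sOpen_eq_top (hC : C.IsHermitian) (hC0 : tl C ≠ 0) (h : S.sOpen = ⊤) :
    relax0 S.V ≠ 0 := by
  intro h0
  have hz := eq_zero_of_lieSpan_skew_eq_top adj_one adj_mul h (by
    rintro _ (rfl | ⟨j, rfl⟩)
    · rw [h0, add_zero]
      exact adj_iad0 _
    · exact adj_iad0 _) ⟨tl C, tl_mem_her0 hC⟩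
  exact hC0 (congrArg Subtype.val hz)

end ObservabilitySpace

end System

end OpenQ

end

noncomputable section

open Set Matrix Complex

namespace OpenQ

attribute [local instance] matNormedAddCommGroup matNormedSpace

namespace System

variable {N m r : ℕ} {S : System N m r}

/-! ### Unitary evolution and damping by scalar relaxation -/

section ClosedSystem

theorem trace_Hu (S : System N m r) (u : Fin m → ℝ) : (S.Hu u).trace = 0 := by
  rw [Hu, trace_add, S.Hd_trace, trace_sum, zero_add]
  exact Finset.sum_eq_zero fun j _ => by rw [trace_smul, S.H_trace, smul_zero]

theorem exists_closed_solution (S : System N m r) {T : ℝ} (hT : 0 ≤ T) {u : ℝ → Fin m → ℝ}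
    (hu : PiecewiseCont T u) :
    ∃ U : ℝ → Mat N, U 0 = 1 ∧ SolvesOn T U (fun t => -(I • (S.Hu (u t) * U t))) := by
  have : CompleteSpace (Mat N) := FiniteDimensional.complete ℝ _
  obtain ⟨U, hU0, hU⟩ := (PiecewiseContOn.comp (a := 0) (b := T) (f := u) hu
    (continuous_toContinuousLinearMap_affine (LinearMap.mulLeft ℝ (I • S.Hd))
      (fun j => LinearMap.mulLeft ℝ (I • S.H j)))).exists_linSol hT 1
  refine ⟨U, hU0, solvesOn_iff.2 ⟨hU.1, hU.2.imp fun B hB t ht htB =>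
    (hB t ht htB).congr_deriv ?_⟩⟩
  change -(LinearMap.mulLeft ℝ (I • S.Hd) + ∑ j, u t j • LinearMap.mulLeft ℝ (I • S.H j)) (U t) = _
  simp only [LinearMap.add_apply, LinearMap.sum_apply, LinearMap.smul_apply,
    LinearMap.mulLeft_apply, Hu, add_mul, Finset.sum_mul, smul_add, Finset.smul_sum,
    smul_mul_assoc, smul_comm I]

variable {T : ℝ} {u : ℝ → Fin m → ℝ} {U : ℝ → Mat N}

theorem conjTranspose_mul_self_of_closed_solution (h0 : U 0 = 1)
    (hU : SolvesOn T U (fun t => -(I • (S.Hu (u t) * U t)))) {t : ℝ} (ht : t ∈ Icc 0 T) :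
    (U t)ᴴ * U t = 1 := by
  have : CompleteSpace (Mat N) := FiniteDimensional.complete ℝ _
  obtain ⟨hc, B, hB⟩ := solvesOn_iff.1 hU
  have h := eq_of_hasDerivAt_zero_off_finset (f := fun t => (U t)ᴴ * U t) ht.1 (B := B) ?_ ?_
  · simpa [h0] using h
  · have hc' := hc.mono (Icc_subset_Icc_right ht.2)
    exact (continuous_id.matrix_conjTranspose.comp_continuousOn hc').mul hc'
  · intro s hs hsB
    have hd := hB s ⟨hs.1, hs.2.trans_le ht.2⟩ hsB
    refine (hasDerivAt_mat_mul (hasDerivAt_mat_conjTranspose hd) hd).congr_deriv ?_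
    rw [conjTranspose_neg, conjTranspose_smul, conjTranspose_mul, (S.Hu_herm _).eq]
    simp [mul_assoc]

theorem det_closed_solution (h0 : U 0 = 1)
    (hU : SolvesOn T U (fun t => -(I • (S.Hu (u t) * U t)))) (hT : 0 ≤ T) : (U T).det = 1 := by
  obtain ⟨hc, B, hB⟩ := solvesOn_iff.1 hU
  have h := eq_of_hasDerivAt_zero_off_finset (f := fun t => (U t).det) hT (B := B) ?_ ?_
  · simpa [h0] using h
  · exact continuous_id.matrix_det.comp_continuousOn hc
  · intro s hs hsB
    refine (hasDerivAt_det (A := -(I • S.Hu (u s))) fun i j => ?_).congr_deriv ?_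
    · rw [neg_mul, smul_mul_assoc]
      exact hasDerivAt_mat_iff.1 (hB s hs hsB) i j
    · rw [trace_neg, trace_smul, trace_Hu, smul_zero, neg_zero, zero_mul]

theorem closedReach_subset (hT : 0 ≤ T) :
    S.closedReach T ⊆ Matrix.specialUnitaryGroup (Fin N) ℂ := by
  rintro _ ⟨u, U, -, h0, hU, rfl⟩
  exact mem_specialUnitaryGroup_iff.2 ⟨mem_unitaryGroup_iff'.2
    (conjTranspose_mul_self_of_closed_solution h0 hU ⟨hT, le_rfl⟩), det_closed_solution h0 hU hT⟩

variable {γ : ℝ}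

theorem conj_mem_her0 {A : Mat N} (hA : Aᴴ * A = 1) {X : Mat N} (hX : X ∈ her0 N) :
    A * X * Aᴴ ∈ her0 N := by
  refine ⟨?_, by rw [trace_mul_comm, ← mul_assoc, hA, one_mul, hX.2]⟩
  change (A * X * Aᴴ)ᴴ = _
  rw [conjTranspose_mul, conjTranspose_mul, conjTranspose_conjTranspose, hX.1.eq, mul_assoc]

/-- If relaxation acts on `her₀(N)` as a multiple `γ` of the identity, then quantum maps are
unitary conjugations, damped by `exp (-γ t)`. -/
theorem isTrajectory_conj (hγ : relax0 S.V = γ • 1) (h0 : U 0 = 1)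
    (hU : SolvesOn T U (fun t => -(I • (S.Hu (u t) * U t)))) {X : Mat N} (hX : X ∈ her0 N) :
    S.IsTrajectory T u X (fun t => Real.exp (-(γ * t)) • (U t * X * (U t)ᴴ)) := by
  obtain ⟨hc, B, hB⟩ := solvesOn_iff.1 hU
  refine ⟨by simp [h0], solvesOn_iff.2 ⟨?_, B, fun t ht htB => ?_⟩⟩
  · have he : ContinuousOn (fun t => Real.exp (-(γ * t))) (Icc 0 T) := by fun_prop
    refine he.smul ((hc.mul continuousOn_const).mul ?_)
    exact continuous_id.matrix_conjTranspose.comp_continuousOn hc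
  · have hd := hB t ht htB
    have hx : Real.exp (-(γ * t)) • (U t * X * (U t)ᴴ) ∈ her0 N := (her0 N).smul_mem _
      (conj_mem_her0 (conjTranspose_mul_self_of_closed_solution h0 hU (Ioo_subset_Icc_self ht)) hX)
    -- Relaxation is known to be scalar only on `her₀(N)`; unitarity keeps the conjugated matrix
    -- there.
    have hrel : relax S.V (Real.exp (-(γ * t)) • (U t * X * (U t)ᴴ)) =
        γ • Real.exp (-(γ * t)) • (U t * X * (U t)ᴴ) :=
      congrArg (fun P : Module.End ℝ (her0 N) => (P ⟨_, hx⟩ : Mat N)) hγ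
    have he : HasDerivAt (fun t => Real.exp (-(γ * t))) (Real.exp (-(γ * t)) * (-γ)) t := by
      have : HasDerivAt (fun t : ℝ => -(γ * t)) (-γ) t := by
        simpa using ((hasDerivAt_id' t).const_mul γ).fun_neg
      exact this.exp
    have hm := hasDerivAt_mat_mul (hasDerivAt_mat_mul hd (hasDerivAt_const t X))
      (hasDerivAt_mat_conjTranspose hd)
    refine (he.smul hm).congr_deriv ?_
    rw [gen, LinearMap.add_apply, hrel]
    change _ = -(I • (S.Hu (u t) * (Real.exp (-(γ * t)) • (U t * X * (U t)ᴴ))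
      - (Real.exp (-(γ * t)) • (U t * X * (U t)ᴴ)) * S.Hu (u t)) + _)
    rw [conjTranspose_neg, conjTranspose_smul, conjTranspose_mul, (S.Hu_herm _).eq]
    simp only [RCLike.star_def, conj_I, mul_zero, add_zero, neg_mul, mul_neg, neg_smul,
      smul_mul_assoc, mul_smul_comm, mul_assoc, neg_neg, mul_smul]
    rw [← smul_sub, smul_comm I]
    module

/-- The propagator is `X ↦ exp(-γ T) U X U†`, whose adjoint exchanges `U` and `U†`; the damping is
split evenly between the two outer factors. -/
theorem adj_propagator_apply (hγ : relax0 S.V = γ • 1) (hT : 0 ≤ T) (hu : PiecewiseCont T u)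
    (h0 : U 0 = 1) (hU : SolvesOn T U (fun t => -(I • (S.Hu (u t) * U t))))
    {F : ℝ → Module.End ℝ (her0 N)} (hF : S.IsPropagator T u F) (X : her0 N) :
    (adj N (F T) X : Mat N) = (Real.exp (-(γ * T / 2)) • U T).conjTranspose * X *
      (Real.exp (-(γ * T / 2)) • U T) := by
  have hTm : T ∈ Icc 0 T := ⟨hT, le_rfl⟩
  have hUU := conjTranspose_mul_self_of_closed_solution h0 hU hTm
  have hUU' : ((U T)ᴴ)ᴴ * (U T)ᴴ = 1 := by
    rw [conjTranspose_conjTranspose]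
    exact mul_eq_one_comm.1 hUU
  have hY : Real.exp (-(γ * T)) • ((U T)ᴴ * (X : Mat N) * U T) ∈ her0 N := by
    have := conj_mem_her0 hUU' X.2
    rw [conjTranspose_conjTranspose] at this
    exact (her0 N).smul_mem _ this
  have hadj : adj N (F T) X = ⟨_, hY⟩ := by
    refine hs_ext fun Z => ofReal_injective ?_
    have hFZ := (hF.trajectory Z).eq hu (isTrajectory_conj hγ h0 hU Z.2) hTm
    rw [hs_adj, ofReal_hs, ofReal_hs, hFZ]
    change _ = ((Real.exp (-(γ * T)) • ((U T)ᴴ * (X : Mat N) * U T)) * (Z : Mat N)).trace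
    rw [mul_smul_comm, smul_mul_assoc, trace_smul, trace_smul, ← mul_assoc, trace_mul_comm]
    simp only [mul_assoc]
  have hexp : Real.exp (-(γ * T / 2)) * Real.exp (-(γ * T / 2)) = Real.exp (-(γ * T)) := by
    rw [← Real.exp_add]; congr 1; ring
  rw [hadj, conjTranspose_smul, star_trivial, smul_mul_assoc, smul_mul_assoc, mul_smul_comm,
    smul_smul, hexp]

theorem mem_heis_iff_of_relax0_eq_smul (hγ : relax0 S.V = γ • 1) (hT : 0 ≤ T)
    (Φ : Module.End ℝ (her0 N)) : Φ ∈ S.heis T ↔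
      ∃ U ∈ S.closedReach T, ∀ X : her0 N, (Φ X : Mat N) =
        (Real.exp (-(γ * T / 2)) • U).conjTranspose * X * (Real.exp (-(γ * T / 2)) • U) := by
  constructor
  · intro h
    obtain ⟨P, ⟨u, F, hu, hF, rfl⟩, rfl⟩ := mem_heis_iff.1 h
    obtain ⟨U, h0, hU⟩ := S.exists_closed_solution hT hu
    exact ⟨U T, ⟨u, U, hu, h0, hU, rfl⟩, adj_propagator_apply hγ hT hu h0 hU hF⟩
  · rintro ⟨_, ⟨u, U, hu, h0, hU, rfl⟩, hΦ⟩
    obtain ⟨F, hF, -⟩ := S.exists_propagator hT hu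
    have : Φ = adj N (F T) := LinearMap.ext fun X => Subtype.ext
      ((hΦ X).trans (adj_propagator_apply hγ hT hu h0 hU hF X).symm)
    rw [this]
    exact adj_mem_heis ⟨u, F, hu, hF, rfl⟩

end ClosedSystem

theorem obs_eq_su {C : Mat N} {hC : C.IsHermitian}
    (h : ∀ T : ℝ, 0 < T → S.obsAt hC T = (su N).toSubmodule) : S.obs hC = (su N).toSubmodule := by
  refine le_antisymm (iSup₂_le fun T _ => obsAt_le_su T) ?_
  rw [← h 1 one_pos]
  exact le_iSup₂_of_le (f := fun (T : ℝ) (_ : T ∈ Ici (0 : ℝ)) => S.obsAt hC T) 1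
    (mem_Ici.2 zero_le_one) le_rfl

end System

theorem two_le_of_tl_ne_zero {N : ℕ} {C : Mat N} (h : tl C ≠ 0) : 2 ≤ N := by
  by_contra hN
  have : Subsingleton (Fin N) := Fin.subsingleton_iff_le_one.2 (by omega)
  refine h (eq_zero_of_scalar_of_trace (c := (tl C).trace) ?_ (trace_tl C))
  ext i j
  obtain rfl := Subsingleton.elim i j
  have : (tl C).trace = tl C i i := Fintype.sum_subsingleton _ i
  simp [this]

end OpenQ

end


theorem corollary4 {N m r : ℕ} (S : OpenQ.System N m r) (C : OpenQ.Mat N)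
    (hC : C.IsHermitian) (hC0 : OpenQ.tl C ≠ 0) (hfull : S.FullyControllable) :
    -- the closed system is observable
    OpenQ.closedObs S.kd C = (OpenQ.su N).toSubmodule ∧
    -- the observability space of the open system decides which states are indistinguishable
    (∀ T : ℝ, 0 ≤ T → ∀ ρA ρB : OpenQ.Mat N, OpenQ.IsDensity ρA → OpenQ.IsDensity ρB →
      (S.Indistinguishable C T ρA ρB ↔ ∀ X ∈ S.obsUpTo hC T, ((ρA - ρB) * X).trace = 0)) ∧
    -- Hamiltonian-controllable systems
    (S.HControllable →
      S.obs hC = OpenQ.closedObs S.kd C ∧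
      ∀ T : ℝ, 0 < T → S.obsAt hC T = OpenQ.closedObs S.kd C) ∧
    -- weakly Hamiltonian-controllable systems
    (∀ γ : ℝ, S.WHControllable γ →
      (∀ T : ℝ, 0 ≤ T → S.closedReach T ⊆ Matrix.specialUnitaryGroup (Fin N) ℂ ∧
        ∀ Φ : Module.End ℝ (OpenQ.her0 N), Φ ∈ S.heis T ↔
          ∃ U ∈ S.closedReach T, ∀ X : OpenQ.her0 N,
            (Φ X : OpenQ.Mat N) =
              (Real.exp (-(γ * T / 2)) • U).conjTranspose * X * (Real.exp (-(γ * T / 2)) • U)) ∧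
      (∀ T : ℝ, 0 < T → S.obsAt hC T =
        (OpenQ.su N).toSubmodule.map (Real.exp (-(γ * T)) • LinearMap.id))) ∧
    -- general systems: a growing subset of `gl(her₀(N))`
    ((∀ T : ℝ, ∀ Φ ∈ S.heisUpTo T, IsUnit Φ) ∧
      (∀ T₁ T₂ : ℝ, T₁ ≤ T₂ → S.heisUpTo T₁ ⊆ S.heisUpTo T₂ ∧ S.obsUpTo hC T₁ ≤ S.obsUpTo hC T₂) ∧
      (∀ T₁ T₂ : ℝ, 0 ≤ T₁ → T₁ ≤ T₂ →
        Module.finrank ℝ (S.obsAt hC T₁) ≤ Module.finrank ℝ (S.obsAt hC T₂)) ∧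
      (OpenQ.relax0 S.V ≠ 0 →
        ∀ T₁ T₂ : ℝ, 0 ≤ T₁ → T₁ < T₂ → S.heisUpTo T₁ ⊂ S.heisUpTo T₂) ∧
      (S.sOpen = ⊤ → OpenQ.relax0 S.V ≠ 0 ∧
        ∀ T : ℝ, 0 < T → Submodule.span ℝ (S.heisUpTo T) = ⊤ ∧
          S.obsUpTo hC T = (OpenQ.su N).toSubmodule) ∧
      (0 < r → IsOpen {V : Fin r → OpenQ.Mat N | OpenQ.relax0 V ≠ 0} ∧
        Dense {V : Fin r → OpenQ.Mat N | OpenQ.relax0 V ≠ 0})) := by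

  have hkd : S.kd = OpenQ.su N := hfull
  have hclosed : OpenQ.closedObs S.kd C = (OpenQ.su N).toSubmodule := by
    rw [hkd]
    exact OpenQ.closedObs_su hC hC0
  refine ⟨hclosed, fun T hT ρA ρB hA hB => OpenQ.System.indistinguishable_iff hC hT hA hB,
    fun hH => ?_, fun γ hγ => ⟨fun T hT => ⟨OpenQ.System.closedReach_subset hT,
      OpenQ.System.mem_heis_iff_of_relax0_eq_smul hγ.2.2 hT⟩, fun T hT => ?_⟩,
    ?_, fun T₁ T₂ h => ⟨OpenQ.System.heisUpTo_mono h,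
      Submodule.span_mono (Set.image_mono (OpenQ.System.heisUpTo_mono h))⟩,
    fun T₁ T₂ h₁ h => OpenQ.System.finrank_obsAt_mono h₁ h,
    fun hne T₁ T₂ h₁ h => OpenQ.System.heisUpTo_ssubset hne h₁ h,
    fun htop => ⟨OpenQ.System.relax0_ne_zero_of_sOpen_eq_top hC hC0 htop, fun T hT =>
      ⟨OpenQ.System.span_heisUpTo_eq_top htop hT,
        OpenQ.System.obsUpTo_eq_su hC0 (OpenQ.System.span_heisUpTo_eq_top htop hT)⟩⟩,
    fun hr => ⟨OpenQ.isOpen_relax0_ne_zero r,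
      OpenQ.dense_relax0_ne_zero hr (OpenQ.two_le_of_tl_ne_zero hC0)⟩⟩
  · rw [hclosed]
    exact ⟨OpenQ.System.obs_eq_su fun T hT =>
      OpenQ.System.obsAt_eq_su_of_hControllable hC0 hH hT,
      fun T hT => OpenQ.System.obsAt_eq_su_of_hControllable hC0 hH hT⟩
  -- The contraction is a nonzero multiple of the identity, so the image of `su(N)` is `su(N)`
  -- itself.
  · rw [OpenQ.System.obsAt_eq_su_of_whControllable hC0 hγ hT,
      Submodule.map_smul _ _ _ (Real.exp_ne_zero _), Submodule.map_id]
  · intro T Φ hΦ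
    obtain ⟨t, ht, hΦ⟩ := OpenQ.System.mem_heisUpTo.1 hΦ
    exact OpenQ.System.isUnit_of_mem_heis ht.1 hΦ
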